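/- Let $\mathbb{F}$ be any field, let $d,n_1,\dots,n_d$ be positive integers, and let $K_{n_1,\dots,n_d}$ be the complete $d$-partite graph on the disjoint union $V=V_1\sqcup\dots\sqcup V_d$ with $|V_\ell|=n_\ell$. Let $\Delta(K_{n_1,\dots,n_d})$ be its clique complex, i.e. the simplicial complex on $V$ whose faces are the cliques of the graph. For a simplicial complex $\Delta$ on $V$, let $\mathbb{F}[\Delta]=S/I_\Delta$ be the Stanley–Reisner ring, where $S=\mathbb{F}[x_v : v\in V]$ and $I_\Delta=\big(\prod_{v\in W}x_v : W\subseteq V,\ W\notin\Delta\big)$, and let $$\beta_{i,i+j}(\mathbb{F}[\Delta])=\dim_{\mathbb{F}}\operatorname{Tor}^S_i(\mathbb{F}[\Delta],\mathbb{F})_{i+j}$$ be its graded Betti numbers. Then for all integers $i,j\ge 0$ $$\beta_{i,i+j}\big(\mathbb{F}[\Delta(K_{n_1,\dots,n_d})]\big)=\sum_{\substack{I\subseteq\{1,\dots,d\}\\ I=\{i_1<\dots<i_j\}}}\ \sum_{\substack{c_1+\dots+c_j=i\\ c_\ell\ge 1\ \forall \ell}}\ \prod_{\ell=1}^{j} c_\ell\binom{n_{i_\ell}}{c_\ell+1}.$$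 (For $j=0$ the right-hand side is $1$ if $i=0$ and $0$ otherwise; for $j>d$ it is $0$.) In particular, if $n_1=\dots=n_d=k$, then for all $i,j\ge 0$ $$\beta_{i,i+j}\big(\mathbb{F}[\Delta(K_{k,\dots,k})]\big)=\binom{d}{j}\sum_{\substack{c_1+\dots+c_j=i\\ c_\ell\ge 1\ \forall \ell}}\ \prod_{\ell=1}^{j} c_\ell\binom{k}{c_\ell+1}.$$ -/

import Mathlib

universe u v

open scoped TensorProduct

noncomputable section

attribute [local instance] MvPolynomial.gradedAlgebra

namespace GradedBetti

variable {σ : Type v} {F : Type u} [Field F]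

/-- The degree-`k` part of the graded free module `⨁ b, S(-deg b)` over `S = F[x_s : s ∈ σ]`,
whose basis element `e_b` sits in degree `deg b`: the vectors all of whose monomial terms
`c · x^m · e_b` satisfy `|m| + deg b = k`. -/
def freeDegree {B : Type*} (deg : B → ℕ) (k : ℕ) :
    Submodule F (B →₀ MvPolynomial σ F) where
  carrier := {p | ∀ b m, MvPolynomial.coeff m (p b) ≠ 0 → m.degree + deg b = k}
  zero_mem' := by
    intro b m h
    simp at h
  add_mem' := by
    intro p q hp hq b m h
    by_cases h1 : MvPolynomial.coeff m (p b) = 0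
    · refine hq b m ?_
      intro h2
      apply h
      simp [h1, h2]
    · exact hp b m h1
  smul_mem' := by
    intro c p hp b m h
    refine hp b m ?_
    intro h1
    apply h
    simp [h1]

/-- The degree-`k` part of the quotient ring `S ⧸ I`. -/
def quotientDegree (I : Ideal (MvPolynomial σ F)) (k : ℕ) :
    Submodule F (MvPolynomial σ F ⧸ I) :=
  (MvPolynomial.homogeneousSubmodule σ F k).map (Ideal.Quotient.mkₐ F I).toLinearMap

/-- A graded free resolution `⋯ → P₂ → P₁ → P₀ → S ⧸ I → 0` of the graded `S`-module `S ⧸ I`,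
with `P_n = ⨁ b : B n, S(-deg b)`; all the maps preserve degrees. -/
structure GradedFreeResolution (I : Ideal (MvPolynomial σ F)) where
  /-- the homogeneous basis of `P_n` -/
  B : ℕ → Type (max u v)
  /-- the degrees of the basis elements -/
  deg : ∀ n, B n → ℕ
  /-- the differential `P_{n+1} → P_n` -/
  d : ∀ n, (B (n + 1) →₀ MvPolynomial σ F) →ₗ[MvPolynomial σ F] (B n →₀ MvPolynomial σ F)
  /-- the augmentation `P₀ → S ⧸ I` -/
  aug : (B 0 →₀ MvPolynomial σ F) →ₗ[MvPolynomial σ F] (MvPolynomial σ F ⧸ I)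
  d_mem : ∀ n k, ∀ p ∈ freeDegree (F := F) (deg (n + 1)) k,
    d n p ∈ freeDegree (F := F) (deg n) k
  aug_mem : ∀ k, ∀ p ∈ freeDegree (F := F) (deg 0) k, aug p ∈ quotientDegree I k
  aug_surjective : Function.Surjective aug
  exact_aug : Function.Exact (d 0) aug
  exact_d : ∀ n, Function.Exact (d (n + 1)) (d n)

/-- The field `F`, viewed as the `S`-module `S ⧸ (x_s : s ∈ σ)`. -/
abbrev ResidueField (σ : Type v) (F : Type u) [Field F] : Type (max u v) :=
  MvPolynomial σ F ⧸ (Ideal.span (Set.range (MvPolynomial.X : σ → MvPolynomial σ F)))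

namespace GradedFreeResolution

variable {I : Ideal (MvPolynomial σ F)} (P : GradedFreeResolution I)

/-- The module `F ⊗_S P_n`. -/
abbrev Tens (n : ℕ) : Type (max u v) :=
  ResidueField σ F ⊗[MvPolynomial σ F] (P.B n →₀ MvPolynomial σ F)

/-- The differential `F ⊗_S P_{n+1} → F ⊗_S P_n`. -/
def tensD (n : ℕ) : P.Tens (n + 1) →ₗ[MvPolynomial σ F] P.Tens n :=
  (P.d n).lTensor (ResidueField σ F)

/-- The degree-`k` part of `F ⊗_S P_n` (`F` being concentrated in degree `0`):
the image of the degree-`k` part of `P_n` under `p ↦ 1 ⊗ p`. -/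
def tensDegree (n k : ℕ) : Submodule F (P.Tens n) :=
  (freeDegree (F := F) (P.deg n) k).map
    ((TensorProduct.mk (MvPolynomial σ F) (ResidueField σ F)
      (P.B n →₀ MvPolynomial σ F) 1).restrictScalars F)

/-- The cycles of `F ⊗_S P_•` in homological degree `n`. -/
def cycles : ∀ n : ℕ, Submodule (MvPolynomial σ F) (P.Tens n)
  | 0 => ⊤
  | n + 1 => LinearMap.ker (P.tensD n)

/-- The boundaries of `F ⊗_S P_•` in homological degree `n`. -/
def boundaries (n : ℕ) : Submodule (MvPolynomial σ F) (P.Tens n) :=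
  LinearMap.range (P.tensD n)

/-- The cycles of homological degree `n` and internal degree `k`. -/
def cyclesDegree (n k : ℕ) : Submodule F (P.Tens n) :=
  (P.cycles n).restrictScalars F ⊓ P.tensDegree n k

/-- The degree-`k` part `Tor_n^S(S ⧸ I, F)_k` of the homology `Tor_n^S(S ⧸ I, F) = cycles/boundaries`
of `F ⊗_S P_•`: the classes of the cycles of degree `k`, inside `(F ⊗_S P_n)/boundaries`. -/
def torDegree (n k : ℕ) : Submodule F (P.Tens n ⧸ P.boundaries n) :=
  (P.cyclesDegree n k).map ((P.boundaries n).mkQ.restrictScalars F)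

end GradedFreeResolution

/-! ### Existence of graded free resolutions -/

lemma exists_decomp {B : Type*} (deg : B → ℕ) (p : B →₀ MvPolynomial σ F) :
    ∃ q : ℕ →₀ (B →₀ MvPolynomial σ F), (∀ k, q k ∈ freeDegree (F := F) deg k) ∧
      (q.sum fun _ x => x) = p := by
  classical
  induction p using Finsupp.induction_linear with
  | zero => exact ⟨0, fun k => Submodule.zero_mem _, by simp⟩
  | add p q hp hq =>
    obtain ⟨p', h1, h2⟩ := hp
    obtain ⟨q', h3, h4⟩ := hq
    refine ⟨p' + q', fun k => Submodule.add_mem _ (h1 k) (h3 k), ?_⟩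
    rw [Finsupp.sum_add_index' (fun _ => rfl) (fun _ _ _ => rfl), h2, h4]
  | single b f =>
    induction f using MvPolynomial.induction_on' with
    | monomial m c =>
      refine ⟨Finsupp.single (m.degree + deg b)
        (Finsupp.single b (MvPolynomial.monomial m c)), fun k => ?_, by simp⟩
      rw [Finsupp.single_apply]
      split_ifs with h
      · intro b' m' h'
        by_cases hb : b = b'
        · subst hb
          rw [Finsupp.single_eq_same, MvPolynomial.coeff_monomial] at h'
          by_cases hm : m = m'
          · rw [← hm, h]
          · simp [hm] at h'
        · rw [Finsupp.single_apply, if_neg hb] at h'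
          simp at h'
      · exact Submodule.zero_mem _
    | add f g hf hg =>
      obtain ⟨p', h1, h2⟩ := hf
      obtain ⟨q', h3, h4⟩ := hg
      refine ⟨p' + q', fun k => Submodule.add_mem _ (h1 k) (h3 k), ?_⟩
      rw [Finsupp.sum_add_index' (fun _ => rfl) (fun _ _ _ => rfl), h2, h4, Finsupp.single_add]

lemma decomp_unique {B : Type*} (deg : B → ℕ) (q : ℕ →₀ (B →₀ MvPolynomial σ F))
    (hq : ∀ k, q k ∈ freeDegree (F := F) deg k) (h0 : (q.sum fun _ x => x) = 0) (k : ℕ) :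
    q k = 0 := by
  classical
  ext b m
  by_contra hne
  have hne' : MvPolynomial.coeff m (q k b) ≠ 0 := by simpa using hne
  have hk := hq k b m hne'
  have hs : MvPolynomial.coeff m ((q.sum fun _ x => x) b) = MvPolynomial.coeff m (q k b) := by
    rw [Finsupp.sum, Finsupp.finsetSum_apply, MvPolynomial.coeff_sum]
    refine Finset.sum_eq_single k ?_ ?_
    · intro l _ hl
      by_contra hc
      exact hl ((hq l b m hc).symm.trans hk)
    · intro hk'
      rw [Finsupp.notMem_support_iff.mp hk']
      simp
  apply hne'
  rw [← hs, h0]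
  simp

/-- A graded free module together with a submodule generated by homogeneous elements. -/
structure SyzygyStage (σ : Type v) (F : Type u) [Field F] where
  B : Type (max u v)
  deg : B → ℕ
  K : Submodule (MvPolynomial σ F) (B →₀ MvPolynomial σ F)
  le_span : K ≤ Submodule.span (MvPolynomial σ F)
    {p | p ∈ K ∧ ∃ k, p ∈ freeDegree (F := F) deg k}

namespace SyzygyStage

variable (A : SyzygyStage σ F)

/-- All the homogeneous elements of the submodule. -/
abbrev Gen : Type (max u v) :=
  Σ k : ℕ, {p : A.B →₀ MvPolynomial σ F // p ∈ A.K ∧ p ∈ freeDegree (F := F) A.deg k}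

/-- The free module on the homogeneous elements of the submodule, mapped onto the submodule. -/
def toFree : (A.Gen →₀ MvPolynomial σ F) →ₗ[MvPolynomial σ F] (A.B →₀ MvPolynomial σ F) :=
  Finsupp.linearCombination _ (fun g : A.Gen => g.2.1)

lemma range_toFree : LinearMap.range A.toFree = A.K := by
  apply le_antisymm
  · rw [toFree, Finsupp.range_linearCombination, Submodule.span_le]
    rintro _ ⟨g, rfl⟩
    exact g.2.2.1
  · refine A.le_span.trans ?_
    rw [toFree, Finsupp.range_linearCombination]
    apply Submodule.span_mono
    rintro p ⟨hp, k, hk⟩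
    exact ⟨⟨k, p, hp, hk⟩, rfl⟩

lemma smul_mem_freeDegree {B : Type*} (deg : B → ℕ) (f : MvPolynomial σ F) (l k j : ℕ)
    (hf : ∀ m, MvPolynomial.coeff m f ≠ 0 → m.degree + l = j)
    (p : B →₀ MvPolynomial σ F) (hp : p ∈ freeDegree (F := F) deg l) (hj : j = k) :
    f • p ∈ freeDegree (F := F) deg k := by
  classical
  subst hj
  intro b m h
  rw [Finsupp.smul_apply, smul_eq_mul, MvPolynomial.coeff_mul] at h
  obtain ⟨x, hx, hne⟩ := Finset.exists_ne_zero_of_sum_ne_zero h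
  have hx : x.1 + x.2 = m := by simpa using hx
  have h1 := hf x.1 (left_ne_zero_of_mul hne)
  have h2 := hp b x.2 (right_ne_zero_of_mul hne)
  rw [← hx, map_add]
  omega

lemma toFree_mem (k : ℕ) (p : A.Gen →₀ MvPolynomial σ F)
    (hp : p ∈ freeDegree (F := F) (fun g : A.Gen => g.1) k) :
    A.toFree p ∈ freeDegree (F := F) A.deg k := by
  rw [toFree, Finsupp.linearCombination_apply, Finsupp.sum]
  refine Submodule.sum_mem _ fun g _ => ?_
  exact smul_mem_freeDegree A.deg (p g) g.1 k k (fun m hm => hp g m hm) _ g.2.2.2 rfl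

lemma ker_toFree_le_span : LinearMap.ker A.toFree ≤ Submodule.span (MvPolynomial σ F)
    {p | p ∈ LinearMap.ker A.toFree ∧
      ∃ k, p ∈ freeDegree (F := F) (fun g : A.Gen => g.1) k} := by
  intro p hp
  obtain ⟨q, hq, rfl⟩ := exists_decomp (fun g : A.Gen => g.1) p
  have key : ∀ k, A.toFree (q k) = 0 := by
    intro k
    have := decomp_unique A.deg (q.mapRange A.toFree (map_zero _))
      (fun k => by simpa using A.toFree_mem k _ (hq k))
      (by
        rw [Finsupp.sum_mapRange_index (fun _ => rfl)]
        rw [LinearMap.mem_ker, Finsupp.sum, map_sum] at hp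
        exact hp) k
    simpa using this
  refine Submodule.sum_mem _ fun k _ => Submodule.subset_span ⟨?_, k, hq k⟩
  exact key k

/-- The next stage: the relations among the homogeneous elements. -/
def next : SyzygyStage σ F where
  B := A.Gen
  deg := fun g => g.1
  K := LinearMap.ker A.toFree
  le_span := A.ker_toFree_le_span

lemma exact_toFree {N : Type*} [AddCommGroup N] [Module (MvPolynomial σ F) N]
    (f : (A.B →₀ MvPolynomial σ F) →ₗ[MvPolynomial σ F] N) (h : A.K = LinearMap.ker f) :
    Function.Exact A.toFree f :=
  LinearMap.exact_iff.mpr (h.symm.trans A.range_toFree.symm)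

end SyzygyStage

/-- The augmentation `S → S ⧸ I`. -/
def stdAug (I : Ideal (MvPolynomial σ F)) :
    (PUnit.{max u v + 1} →₀ MvPolynomial σ F) →ₗ[MvPolynomial σ F] (MvPolynomial σ F ⧸ I) :=
  (Submodule.mkQ I).comp (Finsupp.lapply PUnit.unit)

lemma mem_freeDegree_punit (p : PUnit.{max u v + 1} →₀ MvPolynomial σ F) (k : ℕ) :
    p ∈ freeDegree (F := F) (fun _ : PUnit.{max u v + 1} => 0) k ↔
      (p PUnit.unit).IsHomogeneous k := by
  constructor
  · intro h m hm
    have := h PUnit.unit m hm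
    rwa [add_zero, Finsupp.degree_eq_weight_one] at this
  · intro h b m hm
    have := h hm
    rwa [add_zero, Finsupp.degree_eq_weight_one]

lemma stdAug_le_span (I : Ideal (MvPolynomial σ F))
    (hI : I.IsHomogeneous (MvPolynomial.homogeneousSubmodule σ F)) :
    LinearMap.ker (stdAug I) ≤ Submodule.span (MvPolynomial σ F)
      {p | p ∈ LinearMap.ker (stdAug I) ∧
        ∃ k, p ∈ freeDegree (F := F) (fun _ : PUnit.{max u v + 1} => 0) k} := by
  intro p hp
  have hp' : p PUnit.unit ∈ I := by
    simpa [stdAug, Ideal.Quotient.eq_zero_iff_mem] using hp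
  have hps : p = Finsupp.single PUnit.unit (p PUnit.unit) := by
    ext b
    simp
  rw [hps, ← MvPolynomial.sum_homogeneousComponent (p PUnit.unit), ← Finsupp.lsingle_apply
    (R := MvPolynomial σ F), map_sum]
  refine Submodule.sum_mem _ fun k _ => Submodule.subset_span ⟨?_, k, ?_⟩
  · have h1 : MvPolynomial.homogeneousComponent k (p PUnit.unit) ∈ I := by
      have := hI k hp'
      rw [← MvPolynomial.decomposition.decompose'_apply]
      exact this
    rw [LinearMap.mem_ker]
    simp only [stdAug, LinearMap.comp_apply, Finsupp.lsingle_apply, Finsupp.lapply_apply,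
      Finsupp.single_eq_same]
    exact (Submodule.Quotient.mk_eq_zero I).mpr h1
  · rw [mem_freeDegree_punit]
    simpa using MvPolynomial.homogeneousComponent_isHomogeneous k (p PUnit.unit)

/-- The iterated syzygies of `S ⧸ I`. -/
def stage (I : Ideal (MvPolynomial σ F))
    (hI : I.IsHomogeneous (MvPolynomial.homogeneousSubmodule σ F)) : ℕ → SyzygyStage σ F
  | 0 => ⟨PUnit, fun _ => 0, LinearMap.ker (stdAug I), stdAug_le_span I hI⟩
  | n + 1 => (stage I hI n).next

/-- The standard graded free resolution of `S ⧸ I`, for a homogeneous ideal `I`: `P₀ = S`, and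
`P_{n+1}` is the free module on all homogeneous elements of the `n`-th module of syzygies. -/
def standardResolution (I : Ideal (MvPolynomial σ F))
    (hI : I.IsHomogeneous (MvPolynomial.homogeneousSubmodule σ F)) :
    GradedFreeResolution I where
  B n := (stage I hI n).B
  deg n := (stage I hI n).deg
  d n := (stage I hI n).toFree
  aug := stdAug I
  d_mem n k p hp := (stage I hI n).toFree_mem k p hp
  aug_mem k p hp :=
    ⟨p PUnit.unit, (mem_freeDegree_punit (σ := σ) (F := F) p k).mp hp, rfl⟩
  aug_surjective := by
    intro x
    obtain ⟨f, rfl⟩ := Submodule.mkQ_surjective I x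
    refine ⟨Finsupp.single PUnit.unit f, ?_⟩
    change Submodule.mkQ I (Finsupp.single PUnit.unit f PUnit.unit) = _
    rw [Finsupp.single_eq_same]
  exact_aug := (stage I hI 0).exact_toFree (stdAug I) rfl
  exact_d n := (stage I hI n).next.exact_toFree (stage I hI n).toFree rfl

end GradedBetti

/-- The graded Betti number `β_{i,k}^S(S ⧸ I) = dim_F Tor_i^S(S ⧸ I, F)_k` (as a cardinal, so
that no junk value occurs) of the quotient of `S = F[x_s : s ∈ σ]` by a homogeneous ideal `I`.
As usual, `Tor` is computed from one fixed graded free resolution; the result does not depend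
on it up to isomorphism. -/
def gradedBetti {σ : Type v} {F : Type u} [Field F] (I : Ideal (MvPolynomial σ F))
    (hI : I.IsHomogeneous (MvPolynomial.homogeneousSubmodule σ F)) (i k : ℕ) :
    Cardinal.{max u v} :=
  Module.rank F ((GradedBetti.standardResolution I hI).torDegree i k)

/-- The clique complex `Δ(G)` of a graph. (As everywhere in Mathlib, the empty face is left
implicit: the faces listed are the nonempty ones.) -/
def cliqueComplex {V : Type v} (G : SimpleGraph V) : AbstractSimplicialComplex V where
  faces := {s | s.Nonempty ∧ G.IsClique (s : Set V)}
  isRelLowerSet_faces := by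
    rintro s ⟨hs, hc⟩
    exact ⟨hs, fun t hts ht => ⟨ht, hc.subset (by exact_mod_cast hts)⟩⟩
  singleton_mem := by
    intro x
    exact ⟨Finset.singleton_nonempty x, by simp⟩

/-- The Stanley–Reisner ideal `I_Δ = (x_s : s ∉ Δ)` in `F[x_v : v ∈ V]`. The empty set, which is a
face although the Mathlib structure does not list it, is not a generator. -/
def stanleyReisnerIdeal (F : Type u) [Field F] {V : Type v} (Δ : AbstractSimplicialComplex V) :
    Ideal (MvPolynomial V F) :=
  Ideal.span {f | ∃ s : Finset V, s.Nonempty ∧ s ∉ Δ.faces ∧ f = ∏ v ∈ s, MvPolynomial.X v}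

lemma stanleyReisnerIdeal_isHomogeneous (F : Type u) [Field F] {V : Type v}
    (Δ : AbstractSimplicialComplex V) :
    (stanleyReisnerIdeal F Δ).IsHomogeneous (MvPolynomial.homogeneousSubmodule V F) := by
  apply Ideal.homogeneous_span
  rintro _ ⟨s, _, _, rfl⟩
  refine ⟨∑ v ∈ s, 1, ?_⟩
  exact MvPolynomial.IsHomogeneous.prod s _ _ fun v _ => MvPolynomial.isHomogeneous_X F v

/-- The graded Betti number `β_{i,k}(F[Δ])` of the Stanley–Reisner ring `F[Δ] = S ⧸ I_Δ`. -/
def stanleyReisnerBetti (F : Type u) [Field F] {V : Type v} (Δ : AbstractSimplicialComplex V)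
    (i k : ℕ) : Cardinal.{max u v} :=
  gradedBetti (stanleyReisnerIdeal F Δ) (stanleyReisnerIdeal_isHomogeneous F Δ) i k

/-- The complete `d`-partite graph `K_{n_1,…,n_d}`. -/
abbrev completeMultipartite {d : ℕ} (n : Fin d → ℕ) : SimpleGraph (Σ l : Fin d, Fin (n l)) :=
  SimpleGraph.completeMultipartiteGraph fun l => Fin (n l)

/-- The compositions of `i` indexed by a finite set `I`: families `(c_l)_{l ∈ I}` of integers
`c_l ≥ 1` with sum `i` (extended by `0` outside `I`). -/
def compositionsOn {ι : Type} [DecidableEq ι] (I : Finset ι) (i : ℕ) : Finset (ι → ℕ) :=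
  (Finset.piAntidiag I i).filter fun c => ∀ l ∈ I, 1 ≤ c l

end

/-! ### Comparison of graded free resolutions -/

namespace GradedBetti

/-! The Stanley–Reisner ideal is generated by the products of two distinct variables from the same
part (colour). These generators are adjoined one at a time. For a monomial `u`, the sequence `0 →
S/(I:u)(-u) → S/I → S/(I,u) → 0` shows that the mapping cone of a lift of multiplication by `u`
resolves `S/(I,u)`.

Colours are treated in turn, and so are the vertices of a colour. Let `J` be the ideal of the
earlier colours and `T` the vertices of the current colour already treated. When `w` joins `T`, the
products `vw` with `v ∈ T` are adjoined, and each colon ideal is `J + (T \ {v})`. Those variables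
form a regular sequence on `S/J`. Hence, if `p` is the generating function for `J` (`t` homological,
`X` internal degree), each product contributes `t X² p (1 + tX)^(|T|-1)`. Summed over a part with
`n` vertices, this multiplies `p` by `1 + ∑ i * choose n (i+1) * t^i X^(i+1)`. Expanding the product
over all parts and reading off `t^i X^(i+j)` gives the formula, the subset `I` being the set of
parts whose nonconstant summand is chosen.

Mapping cones need not be minimal, but here every label in homological degree `n` satisfies `∑_l
(colour degree - 1) = n` with truncated subtraction. Labels in consecutive degrees therefore never
coincide, and the differential has no unit entries. A minimal resolution computes the Betti numbers
by counting its basis, and uniqueness up to homotopy transfers this to the resolution used in the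
definition.

The main lemmas are `rank_torDegree_eq_rank_tensDegree`, `Frame.tensD_toResolution`,
`HasFrame.cone`, `hasFrame_adjoin_products` and `pointSeries_succ`. -/

theorem exists_dependent_seq {α : ℕ → Type*} (G : ∀ n, α n → Prop)
    (R : ∀ n, α n → α (n + 1) → Prop) (a : α 0) (ha : G 0 a)
    (step : ∀ n x, G n x → ∃ y, G (n + 1) y ∧ R n x y) :
    ∃ f : ∀ n, α n, f 0 = a ∧ ∀ n, G n (f n) ∧ R n (f n) (f (n + 1)) := by
  choose next hG hR using step
  let f : ∀ n, {x : α n // G n x} := fun n =>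
    Nat.rec (motive := fun n => {x : α n // G n x}) ⟨a, ha⟩
      (fun n x => ⟨next n x.1 x.2, hG n x.1 x.2⟩) n
  exact ⟨fun n => (f n).1, rfl, fun n => ⟨(f n).2, hR n (f n).1 (f n).2⟩⟩

/-- Projectivity of a free module. The sets `T b` constrain the chosen images of the basis vectors,
which is how degrees and labels are controlled during lifting. -/
theorem exists_finsupp_lift {R B X Y : Type*} [CommRing R] [AddCommGroup X] [AddCommGroup Y]
    [Module R X] [Module R Y] (d : X →ₗ[R] Y) (ψ : (B →₀ R) →ₗ[R] Y) (T : B → Set X)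
    (h : ∀ b, ∃ x ∈ T b, d x = ψ (Finsupp.single b 1)) :
    ∃ φ : (B →₀ R) →ₗ[R] X, (∀ b, φ (Finsupp.single b 1) ∈ T b) ∧ d ∘ₗ φ = ψ := by
  choose x hx hd using h
  refine ⟨Finsupp.linearCombination R x, fun b => by simpa using hx b, ?_⟩
  ext b
  simp [hd]

section Comparison

variable {σ : Type v} {F : Type u} [Field F]

theorem single_one_mem_freeDegree {B : Type*} (deg : B → ℕ) (b : B) :
    Finsupp.single b (1 : MvPolynomial σ F) ∈ freeDegree (F := F) deg (deg b) := by
  classical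
  intro b' m h
  rw [Finsupp.single_apply] at h
  split_ifs at h with hb
  · rw [MvPolynomial.coeff_one] at h
    split_ifs at h with hm
    · simp [← hm, ← hb]
    · exact absurd rfl h
  · simp at h

theorem map_mem_freeDegree {B C : Type*} (deg : B → ℕ) (deg' : C → ℕ)
    (φ : (B →₀ MvPolynomial σ F) →ₗ[MvPolynomial σ F] (C →₀ MvPolynomial σ F))
    (h : ∀ b, φ (Finsupp.single b 1) ∈ freeDegree (F := F) deg' (deg b)) (k : ℕ)
    (p : B →₀ MvPolynomial σ F) (hp : p ∈ freeDegree (F := F) deg k) :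
    φ p ∈ freeDegree (F := F) deg' k := by
  have hφ : φ p = p.sum fun b f => f • φ (Finsupp.single b 1) := by
    conv_lhs => rw [← Finsupp.sum_single p, Finsupp.sum, map_sum]
    refine Finset.sum_congr rfl fun b _ => ?_
    change φ (Finsupp.single b (p b)) = p b • φ (Finsupp.single b 1)
    rw [← map_smul, Finsupp.smul_single_one]
  rw [hφ]
  exact Submodule.sum_mem _ fun b _ =>
    SyzygyStage.smul_mem_freeDegree deg' (p b) (deg b) k k (fun m hm => hp b m hm) _ (h b) rfl

theorem smul_one_residueField (p : MvPolynomial σ F) :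
    p • (1 : ResidueField σ F) =
      algebraMap F (ResidueField σ F) (MvPolynomial.constantCoeff p) := by
  rw [← Algebra.algebraMap_eq_smul_one]
  have h : algebraMap (MvPolynomial σ F) (ResidueField σ F) =
      (algebraMap F (ResidueField σ F)).comp MvPolynomial.constantCoeff := by
    refine MvPolynomial.ringHom_ext (fun r => ?_) (fun i => ?_)
    · rw [RingHom.comp_apply, MvPolynomial.constantCoeff_C]
      rfl
    · rw [RingHom.comp_apply, MvPolynomial.constantCoeff_X, map_zero]
      exact Ideal.Quotient.eq_zero_iff_mem.mpr (Ideal.subset_span ⟨i, rfl⟩)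
  exact RingHom.congr_fun h p

namespace GradedFreeResolution

variable {I : Ideal (MvPolynomial σ F)} (P Q : GradedFreeResolution I)

/-- The degree-`k` component of `y` works: the differential preserves degrees and homogeneous
decompositions are unique. -/
theorem exists_preimage_freeDegree (n k : ℕ) (y : P.B (n + 1) →₀ MvPolynomial σ F)
    (hy : P.d n y ∈ freeDegree (F := F) (P.deg n) k) :
    ∃ x ∈ freeDegree (F := F) (P.deg (n + 1)) k, P.d n x = P.d n y := by
  obtain ⟨q, hq, rfl⟩ := exists_decomp (F := F) (P.deg (n + 1)) y
  refine ⟨q k, hq k, ?_⟩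
  have key := decomp_unique (P.deg n) (q.mapRange (P.d n) (map_zero _) -
      Finsupp.single k (P.d n (q.sum fun _ x => x)))
    (fun l => by
      rw [Finsupp.sub_apply, Finsupp.mapRange_apply, Finsupp.single_apply]
      refine Submodule.sub_mem _ (P.d_mem n l _ (hq l)) ?_
      split_ifs with h
      · exact h ▸ hy
      · exact Submodule.zero_mem _)
    (by
      rw [Finsupp.sum_sub_index (fun _ _ _ => rfl), Finsupp.sum_mapRange_index (fun _ => rfl),
        Finsupp.sum_single_index rfl, sub_eq_zero, Finsupp.sum, Finsupp.sum, map_sum]) k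
  rwa [Finsupp.sub_apply, Finsupp.mapRange_apply, Finsupp.single_eq_same, sub_eq_zero] at key

theorem exists_comparison
    (f₀ : (P.B 0 →₀ MvPolynomial σ F) →ₗ[MvPolynomial σ F] (Q.B 0 →₀ MvPolynomial σ F))
    (hf₀ : ∀ k, ∀ p ∈ freeDegree (F := F) (P.deg 0) k, f₀ p ∈ freeDegree (F := F) (Q.deg 0) k)
    (haug : ∀ p, Q.aug (f₀ p) = P.aug p) :
    ∃ f : ∀ n, (P.B n →₀ MvPolynomial σ F) →ₗ[MvPolynomial σ F] (Q.B n →₀ MvPolynomial σ F),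
      f 0 = f₀ ∧
      (∀ n k, ∀ p ∈ freeDegree (F := F) (P.deg n) k, f n p ∈ freeDegree (F := F) (Q.deg n) k) ∧
      ∀ n, Q.d n ∘ₗ f (n + 1) = f n ∘ₗ P.d n := by
  obtain ⟨f, h0, h⟩ := exists_dependent_seq
    (α := fun n =>
      (P.B n →₀ MvPolynomial σ F) →ₗ[MvPolynomial σ F] (Q.B n →₀ MvPolynomial σ F))
    -- The invariant contains the liftability condition for the next step: `φ ∘ d` lands in the
    -- image of the differential of `Q`.
    (fun n φ => (∀ k, ∀ p ∈ freeDegree (F := F) (P.deg n) k,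
      φ p ∈ freeDegree (F := F) (Q.deg n) k) ∧ ∀ p, ∃ y, Q.d n y = φ (P.d n p))
    (fun n φ ψ => Q.d n ∘ₗ ψ = φ ∘ₗ P.d n) f₀
    ⟨hf₀, fun p => (Q.exact_aug _).mp (by rw [haug]; exact (P.exact_aug _).mpr ⟨p, rfl⟩)⟩
    (by
      rintro n φ ⟨hφ, hex⟩
      obtain ⟨ψ, hψ, hd⟩ := exists_finsupp_lift (Q.d n) (φ ∘ₗ P.d n)
        (fun b => {y | y ∈ freeDegree (F := F) (Q.deg (n + 1)) (P.deg (n + 1) b)}) (fun b => by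
          obtain ⟨y, hy⟩ := hex (Finsupp.single b 1)
          obtain ⟨x, hx, hxy⟩ := Q.exists_preimage_freeDegree n (P.deg (n + 1) b) y
            (hy ▸ hφ _ _ (P.d_mem _ _ _ (single_one_mem_freeDegree _ b)))
          exact ⟨x, hx, hxy.trans hy⟩)
      refine ⟨ψ, ⟨map_mem_freeDegree _ _ ψ hψ, fun p => (Q.exact_d n _).mp ?_⟩, hd⟩
      have h1 : P.d n (P.d (n + 1) p) = 0 := (P.exact_d n _).mpr ⟨p, rfl⟩
      rw [← LinearMap.comp_apply, hd, LinearMap.comp_apply, h1, map_zero])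
  exact ⟨f, h0, fun n => (h n).1.1, fun n => (h n).2⟩

/-- Degrees are ignored here, because the homotopy only serves to show that certain elements are
boundaries. -/
theorem exists_homotopy
    (φ : ∀ n, (P.B n →₀ MvPolynomial σ F) →ₗ[MvPolynomial σ F] (Q.B n →₀ MvPolynomial σ F))
    (hφ : ∀ n, Q.d n ∘ₗ φ (n + 1) = φ n ∘ₗ P.d n) (h₀ : ∀ p, Q.aug (φ 0 p) = 0) :
    ∃ h : ∀ n, (P.B n →₀ MvPolynomial σ F) →ₗ[MvPolynomial σ F]
        (Q.B (n + 1) →₀ MvPolynomial σ F),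
      φ 0 = Q.d 0 ∘ₗ h 0 ∧ ∀ n, φ (n + 1) = Q.d (n + 1) ∘ₗ h (n + 1) + h n ∘ₗ P.d n := by
  obtain ⟨k, -, hk⟩ := exists_finsupp_lift (Q.d 0) (φ 0) (fun _ => Set.univ) (fun b => by
    obtain ⟨y, hy⟩ := (Q.exact_aug _).mp (h₀ (Finsupp.single b 1))
    exact ⟨y, trivial, hy⟩)
  obtain ⟨h, h0, hs⟩ := exists_dependent_seq
    (α := fun n =>
      (P.B n →₀ MvPolynomial σ F) →ₗ[MvPolynomial σ F] (Q.B (n + 1) →₀ MvPolynomial σ F))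
    (fun n h => ∀ p, Q.d n ((φ (n + 1) - h ∘ₗ P.d n) p) = 0)
    (fun n h h' => Q.d (n + 1) ∘ₗ h' = φ (n + 1) - h ∘ₗ P.d n) k
    (fun p => by
      have h1 := LinearMap.congr_fun (hφ 0) p
      have h2 := LinearMap.congr_fun hk (P.d 0 p)
      simp only [LinearMap.comp_apply] at h1 h2
      rw [LinearMap.sub_apply, map_sub, LinearMap.comp_apply, h1, h2, sub_self])
    (by
      intro n h hh
      obtain ⟨h', -, hd⟩ := exists_finsupp_lift (Q.d (n + 1)) (φ (n + 1) - h ∘ₗ P.d n)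
        (fun _ => Set.univ) (fun b => by
          obtain ⟨y, hy⟩ := (Q.exact_d n _).mp (hh (Finsupp.single b 1))
          exact ⟨y, trivial, hy⟩)
      refine ⟨h', fun p => ?_, hd⟩
      have h1 := LinearMap.congr_fun (hφ (n + 1)) p
      have h2 := LinearMap.congr_fun hd (P.d (n + 1) p)
      have h3 : P.d n (P.d (n + 1) p) = 0 := (P.exact_d n _).mpr ⟨p, rfl⟩
      simp only [LinearMap.comp_apply, LinearMap.sub_apply, h3, map_zero, sub_zero] at h1 h2
      rw [LinearMap.sub_apply, map_sub, LinearMap.comp_apply, h1, h2, sub_self])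
  refine ⟨h, by rw [h0, hk], fun n => ?_⟩
  rw [(hs n).2]
  exact LinearMap.ext fun p => (sub_add_cancel (φ (n + 1) p) (h n (P.d n p))).symm

theorem map_mem_tensDegree {n k : ℕ}
    (f : (P.B n →₀ MvPolynomial σ F) →ₗ[MvPolynomial σ F] (Q.B n →₀ MvPolynomial σ F))
    (hf : ∀ p ∈ freeDegree (F := F) (P.deg n) k, f p ∈ freeDegree (F := F) (Q.deg n) k)
    (x : P.Tens n) (hx : x ∈ P.tensDegree n k) :
    f.lTensor (ResidueField σ F) x ∈ Q.tensDegree n k := by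
  obtain ⟨p, hp, rfl⟩ := hx
  exact ⟨f p, hf p hp, by simp⟩

theorem mem_cycles_of_tensD_eq_zero (hQ : ∀ n, Q.tensD n = 0) (n : ℕ)
    (f : ∀ n, (Q.B n →₀ MvPolynomial σ F) →ₗ[MvPolynomial σ F] (P.B n →₀ MvPolynomial σ F))
    (hf : ∀ n, P.d n ∘ₗ f (n + 1) = f n ∘ₗ Q.d n) (x : Q.Tens n) :
    (f n).lTensor (ResidueField σ F) x ∈ P.cycles n := by
  cases n with
  | zero => exact Submodule.mem_top
  | succ n =>
    change (P.d n).lTensor (ResidueField σ F) _ = 0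
    have h := LinearMap.congr_fun (congrArg (LinearMap.lTensor (ResidueField σ F)) (hf n)) x
    rw [LinearMap.lTensor_comp_apply, LinearMap.lTensor_comp_apply] at h
    rw [h]
    have h2 : (Q.d n).lTensor (ResidueField σ F) x = 0 := LinearMap.congr_fun (hQ n) x
    rw [h2, map_zero]

/-- Such a `φ` is null-homotopic, and the summand `h ∘ d` of the homotopy formula vanishes on
cycles. -/
theorem lTensor_mem_boundaries {n : ℕ}
    (φ : ∀ n, (P.B n →₀ MvPolynomial σ F) →ₗ[MvPolynomial σ F] (P.B n →₀ MvPolynomial σ F))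
    (hφ : ∀ n, P.d n ∘ₗ φ (n + 1) = φ n ∘ₗ P.d n) (h₀ : ∀ p, P.aug (φ 0 p) = 0)
    (x : P.Tens n) (hx : x ∈ P.cycles n) :
    (φ n).lTensor (ResidueField σ F) x ∈ P.boundaries n := by
  obtain ⟨h, h0, hs⟩ := P.exists_homotopy P φ hφ h₀
  cases n with
  | zero =>
    rw [h0, LinearMap.lTensor_comp_apply]
    exact ⟨_, rfl⟩
  | succ n =>
    have hx' : (P.d n).lTensor (ResidueField σ F) x = 0 := hx
    rw [hs, LinearMap.lTensor_add, LinearMap.add_apply, LinearMap.lTensor_comp_apply,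
      LinearMap.lTensor_comp_apply, hx', map_zero, add_zero]
    exact ⟨_, rfl⟩

/-- Comparison maps `f : Q → P` and `g : P → Q` are mutually inverse up to homotopy. Since `F ⊗ Q`
has zero differential, `g ∘ f` becomes the identity on it, while `f ∘ g` is the identity modulo
boundaries. So `f` induces an isomorphism from `F ⊗ Q` onto the homology of `F ⊗ P`, degree by
degree. -/
theorem rank_torDegree_eq_rank_tensDegree (hQ : ∀ n, Q.tensD n = 0)
    (f₀ : (Q.B 0 →₀ MvPolynomial σ F) →ₗ[MvPolynomial σ F] (P.B 0 →₀ MvPolynomial σ F))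
    (hf₀ : ∀ k, ∀ p ∈ freeDegree (F := F) (Q.deg 0) k, f₀ p ∈ freeDegree (F := F) (P.deg 0) k)
    (hfaug : ∀ p, P.aug (f₀ p) = Q.aug p)
    (g₀ : (P.B 0 →₀ MvPolynomial σ F) →ₗ[MvPolynomial σ F] (Q.B 0 →₀ MvPolynomial σ F))
    (hg₀ : ∀ k, ∀ p ∈ freeDegree (F := F) (P.deg 0) k, g₀ p ∈ freeDegree (F := F) (Q.deg 0) k)
    (hgaug : ∀ p, Q.aug (g₀ p) = P.aug p) (n k : ℕ) :
    Module.rank F (P.torDegree n k) = Module.rank F (Q.tensDegree n k) := by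
  obtain ⟨f, f0, hfd, hf⟩ := Q.exists_comparison P f₀ hf₀ hfaug
  obtain ⟨g, g0, hgd, hg⟩ := P.exists_comparison Q g₀ hg₀ hgaug
  have hgf : ∀ x : Q.Tens n,
      (g n).lTensor (ResidueField σ F) ((f n).lTensor (ResidueField σ F) x) = x := by
    intro x
    have hx : x ∈ Q.cycles n := by
      cases n with
      | zero => exact Submodule.mem_top
      | succ n => exact LinearMap.congr_fun (hQ n) x
    have h := Q.lTensor_mem_boundaries (fun n => g n ∘ₗ f n - LinearMap.id)
      (fun n => by
        rw [LinearMap.comp_sub, LinearMap.sub_comp, ← LinearMap.comp_assoc, hg,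
          LinearMap.comp_assoc, hf, LinearMap.comp_assoc, LinearMap.id_comp, LinearMap.comp_id])
      (fun p => by simp [f0, g0, hgaug, hfaug]) x hx
    rw [boundaries, hQ, LinearMap.range_zero, Submodule.mem_bot, LinearMap.lTensor_sub,
      LinearMap.sub_apply, LinearMap.lTensor_comp_apply, LinearMap.lTensor_id,
      LinearMap.id_apply, sub_eq_zero] at h
    exact h
  have hfg : ∀ x ∈ P.cycles n, (f n).lTensor (ResidueField σ F)
      ((g n).lTensor (ResidueField σ F) x) - x ∈ P.boundaries n := by
    intro x hx
    have h := P.lTensor_mem_boundaries (fun n => f n ∘ₗ g n - LinearMap.id)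
      (fun n => by
        rw [LinearMap.comp_sub, LinearMap.sub_comp, ← LinearMap.comp_assoc, hf,
          LinearMap.comp_assoc, hg, LinearMap.comp_assoc, LinearMap.id_comp, LinearMap.comp_id])
      (fun p => by simp [f0, g0, hgaug, hfaug]) x hx
    rwa [LinearMap.lTensor_sub, LinearMap.sub_apply, LinearMap.lTensor_comp_apply,
      LinearMap.lTensor_id, LinearMap.id_apply] at h
  let α : Q.tensDegree n k →ₗ[F] P.torDegree n k :=
    (((P.boundaries n).mkQ.restrictScalars F ∘ₗ
      ((f n).lTensor (ResidueField σ F)).restrictScalars F) ∘ₗ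
        (Q.tensDegree n k).subtype).codRestrict _ (fun x =>
          ⟨_, ⟨P.mem_cycles_of_tensD_eq_zero Q hQ n f hf x.1,
            Q.map_mem_tensDegree P (f n) (hfd n k) x.1 x.2⟩, rfl⟩)
  refine (LinearEquiv.rank_eq (LinearEquiv.ofBijective α ⟨?_, ?_⟩)).symm
  · intro x y hxy
    have h1 : (P.boundaries n).mkQ ((f n).lTensor (ResidueField σ F) x.1) =
        (P.boundaries n).mkQ ((f n).lTensor (ResidueField σ F) y.1) := congrArg Subtype.val hxy
    obtain ⟨z, hz⟩ := (Submodule.Quotient.eq _).mp h1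
    have h2 := congrArg ((g n).lTensor (ResidueField σ F)) hz
    rw [map_sub, hgf, hgf, tensD, ← LinearMap.lTensor_comp_apply, ← hg,
      LinearMap.lTensor_comp_apply] at h2
    have h3 : x.1 - y.1 = 0 := h2.symm.trans (LinearMap.congr_fun (hQ n) _)
    exact Subtype.ext (sub_eq_zero.mp h3)
  · rintro ⟨_, y, ⟨hy, hyk⟩, rfl⟩
    refine ⟨⟨_, P.map_mem_tensDegree Q (g n) (hgd n k) y hyk⟩, Subtype.ext ?_⟩
    exact (Submodule.Quotient.eq _).mpr (hfg y hy)

theorem rank_tensDegree (n k : ℕ) :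
    Module.rank F (Q.tensDegree n k) = Cardinal.mk {b : Q.B n // Q.deg n b = k} := by
  classical
  let e : {b : Q.B n // Q.deg n b = k} → Q.Tens n := fun b => 1 ⊗ₜ Finsupp.single b.1 1
  have hA : Nontrivial (ResidueField σ F) := by
    refine Ideal.Quotient.nontrivial_iff.mpr fun h => ?_
    have h1 : (1 : MvPolynomial σ F) ∈ Ideal.span (Set.range MvPolynomial.X) := h ▸ trivial
    have h2 : Ideal.span (Set.range (MvPolynomial.X : σ → MvPolynomial σ F)) ≤
        RingHom.ker (MvPolynomial.constantCoeff (σ := σ) (R := F)) := by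
      rw [Ideal.span_le]
      rintro _ ⟨i, rfl⟩
      simp
    simpa using h2 h1
  have hli : LinearIndependent F e := by
    rw [linearIndependent_iff']
    intro s c hc b hb
    let l : Q.Tens n →ₗ[MvPolynomial σ F] ResidueField σ F := Finsupp.lapply b.1 ∘ₗ
      (TensorProduct.finsuppScalarRight (MvPolynomial σ F) (MvPolynomial σ F)
        (ResidueField σ F) (Q.B n)).toLinearMap
    have h1 : ∀ i, l (c i • e i) =
        if i = b then algebraMap F (ResidueField σ F) (c i) else 0 := by
      intro i
      have h2 : l (e i) = Finsupp.single i.1 (1 : MvPolynomial σ F) b.1 • 1 :=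
        TensorProduct.finsuppScalarRight_apply_tmul_apply ..
      rw [← algebraMap_smul (MvPolynomial σ F) (c i) (e i), map_smul, h2, Finsupp.single_apply]
      by_cases hi : i = b
      · subst hi
        rw [if_pos rfl, if_pos rfl, one_smul, algebraMap_smul, Algebra.algebraMap_eq_smul_one]
      · rw [if_neg hi, if_neg (fun h => hi (Subtype.ext h)), zero_smul, smul_zero]
    have h := congrArg l hc
    rw [map_sum, map_zero, Finset.sum_congr rfl fun i _ => h1 i] at h
    rw [Finset.sum_ite_eq' s b, if_pos hb] at h
    exact (map_eq_zero _).mp h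
  have hspan : Q.tensDegree n k = Submodule.span F (Set.range e) := by
    apply le_antisymm
    · rintro _ ⟨p, hp, rfl⟩
      change (1 : ResidueField σ F) ⊗ₜ[MvPolynomial σ F] p ∈ _
      rw [← Finsupp.sum_single p, Finsupp.sum, TensorProduct.tmul_sum]
      refine Submodule.sum_mem _ fun b _ => ?_
      rw [← Finsupp.smul_single_one, TensorProduct.tmul_smul, TensorProduct.smul_tmul',
        smul_one_residueField]
      by_cases h0 : MvPolynomial.constantCoeff (p b) = 0
      · rw [h0, map_zero, TensorProduct.zero_tmul]
        exact Submodule.zero_mem _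
      -- A nonzero constant term is a term of exponent `0`, so homogeneity of `p` forces the degree
      -- of `b` itself to be `k`.
      · have hb : Q.deg n b = k := by simpa using hp b 0 h0
        rw [Algebra.algebraMap_eq_smul_one, ← TensorProduct.smul_tmul']
        exact Submodule.smul_mem _ _ (Submodule.subset_span ⟨⟨b, hb⟩, rfl⟩)
    · rw [Submodule.span_le]
      rintro _ ⟨b, rfl⟩
      refine ⟨Finsupp.single b.1 1, ?_, rfl⟩
      have h := single_one_mem_freeDegree (σ := σ) (F := F) (Q.deg n) b.1
      rwa [b.2] at h
  rw [hspan, rank_span hli, Cardinal.mk_range_eq e hli.injective]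

end GradedFreeResolution

end Comparison

end GradedBetti

/-! ### Multigraded resolutions supported on labelled complexes of vector spaces -/

namespace GradedBetti

/-- The coordinate subspace spanned by the basis vectors whose label divides `m`. -/
def labelLevel (F : Type*) [Field F] {σ : Type*} {B : Type*} (deg : B → σ →₀ ℕ) (m : σ →₀ ℕ) :
    Submodule F (B →₀ F) :=
  Finsupp.supported F F {b | deg b ≤ m}

/-- A finite complex of based `F`-vector spaces with basis vectors labelled by monomials,
supporting a multigraded free resolution of `S ⧸ I`, where `I` is the monomial ideal whose
monomials have their exponents in `M`. -/
structure Frame (σ : Type v) (F : Type u) [Field F] (M : Set (σ →₀ ℕ)) where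
  /-- the basis in homological degree `n` -/
  B : ℕ → Type (max u v)
  finite : ∀ n, Fintype (B n)
  unique : Unique (B 0)
  /-- the labels -/
  deg : ∀ n, B n → (σ →₀ ℕ)
  deg_zero : ∀ b, deg 0 b = 0
  /-- the differential -/
  d : ∀ n, (B (n + 1) →₀ F) →ₗ[F] (B n →₀ F)
  d_mem : ∀ n m, ∀ x ∈ labelLevel F (deg (n + 1)) m, d n x ∈ labelLevel F (deg n) m
  -- Level `m` must resolve the multidegree-`m` part of `S ⧸ I`, which is one-dimensional for `m ∉
  -- M` and zero for `m ∈ M`. This is the reason for the next two conditions.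
  d_zero : ∀ m ∉ M, ∀ x ∈ labelLevel F (deg 1) m, d 0 x = 0
  exists_preimage : ∀ m ∈ M, ∀ x, ∃ y ∈ labelLevel F (deg 1) m, d 0 y = x
  d_comp : ∀ n x, d n (d (n + 1) x) = 0
  exact : ∀ n m, ∀ x ∈ labelLevel F (deg (n + 1)) m, d n x = 0 →
    ∃ y ∈ labelLevel F (deg (n + 2)) m, d (n + 1) y = x

section Homogenization

variable {σ : Type v} {F : Type u} [Field F] {B : Type*} (deg : B → σ →₀ ℕ)

theorem mem_labelLevel {m : σ →₀ ℕ} {x : B →₀ F} :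
    x ∈ labelLevel F deg m ↔ ∀ b, x b ≠ 0 → deg b ≤ m := by
  simp [labelLevel, Finsupp.mem_supported, Set.subset_def]

/-- The homogeneous vector of degree `m` with the given coefficients. -/
noncomputable def homogenize (m : σ →₀ ℕ) : (B →₀ F) →ₗ[F] (B →₀ MvPolynomial σ F) :=
  Finsupp.lsum F fun b => (Finsupp.lsingle b).comp (MvPolynomial.monomial (m - deg b))

theorem homogenize_single (m : σ →₀ ℕ) (b : B) (c : F) :
    homogenize deg m (Finsupp.single b c) =
      Finsupp.single b (MvPolynomial.monomial (m - deg b) c) := by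
  simp [homogenize]

theorem homogenize_apply (m : σ →₀ ℕ) (x : B →₀ F) (b : B) :
    homogenize deg m x b = MvPolynomial.monomial (m - deg b) (x b) := by
  classical
  induction x using Finsupp.induction_linear with
  | zero => simp
  | add x y hx hy => rw [map_add, Finsupp.add_apply, hx, hy, Finsupp.add_apply, map_add]
  | single a c =>
    rw [homogenize_single, Finsupp.single_apply, Finsupp.single_apply]
    split_ifs with h
    · rw [h]
    · simp

open Classical in
/-- The coefficients of the component of degree `m` of a vector. -/
noncomputable def multiComponent (m : σ →₀ ℕ) : (B →₀ MvPolynomial σ F) →ₗ[F] (B →₀ F) :=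
  Finsupp.lsum F fun b => (Finsupp.lsingle b).comp
    (if deg b ≤ m then MvPolynomial.lcoeff F (m - deg b) else 0)

open Classical in
theorem multiComponent_apply (m : σ →₀ ℕ) (p : B →₀ MvPolynomial σ F) (b : B) :
    multiComponent deg m p b =
      if deg b ≤ m then MvPolynomial.coeff (m - deg b) (p b) else 0 := by
  induction p using Finsupp.induction_linear with
  | zero => simp
  | add x y hx hy =>
    rw [map_add, Finsupp.add_apply, hx, hy, Finsupp.add_apply]
    split_ifs <;> simp
  | single a c =>
    rw [multiComponent, Finsupp.lsum_single, LinearMap.comp_apply, Finsupp.lsingle_apply,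
      Finsupp.single_apply, Finsupp.single_apply]
    by_cases h : a = b
    · subst h
      by_cases h' : deg a ≤ m <;> simp [h']
    · simp [h]

theorem multiComponent_add_apply (m : σ →₀ ℕ) (p : B →₀ MvPolynomial σ F) (b : B) :
    multiComponent deg (m + deg b) p b = MvPolynomial.coeff m (p b) := by
  rw [multiComponent_apply, if_pos le_add_self, add_tsub_cancel_right]

theorem multiComponent_mem (m : σ →₀ ℕ) (p : B →₀ MvPolynomial σ F) :
    multiComponent deg m p ∈ labelLevel F deg m := by
  classical
  rw [mem_labelLevel]
  intro b h
  rw [multiComponent_apply] at h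
  by_contra h'
  exact h (if_neg h')

theorem eq_of_multiComponent_eq {p q : B →₀ MvPolynomial σ F}
    (h : ∀ m, multiComponent deg m p = multiComponent deg m q) : p = q := by
  ext b m
  rw [← multiComponent_add_apply, h, multiComponent_add_apply]

theorem multiComponent_homogenize {m : σ →₀ ℕ} {x : B →₀ F} (hx : x ∈ labelLevel F deg m) :
    multiComponent deg m (homogenize deg m x) = x := by
  classical
  ext b
  rw [multiComponent_apply, homogenize_apply]
  by_cases h : x b = 0
  · simp [h]
  · rw [if_pos ((mem_labelLevel deg).mp hx b h), MvPolynomial.coeff_monomial, if_pos rfl]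

theorem multiComponent_homogenize_of_ne {m m' : σ →₀ ℕ} (hm : m ≠ m') {x : B →₀ F}
    (hx : x ∈ labelLevel F deg m) : multiComponent deg m' (homogenize deg m x) = 0 := by
  classical
  ext b
  rw [multiComponent_apply, homogenize_apply, Finsupp.zero_apply]
  by_cases h : x b = 0
  · simp [h]
  · split_ifs with h'
    · rw [MvPolynomial.coeff_monomial, if_neg]
      intro h2
      rw [← tsub_add_cancel_of_le ((mem_labelLevel deg).mp hx b h), h2,
        tsub_add_cancel_of_le h'] at hm
      exact hm rfl
    · rfl

theorem finite_multiComponent_ne_zero (p : B →₀ MvPolynomial σ F) :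
    ∃ s : Finset (σ →₀ ℕ), ∀ m ∉ s, multiComponent deg m p = 0 := by
  classical
  refine ⟨p.support.biUnion fun b => (p b).support.image (· + deg b), fun m hm => ?_⟩
  ext b
  rw [multiComponent_apply, Finsupp.zero_apply]
  split_ifs with h
  · by_contra hne
    refine hm (Finset.mem_biUnion.mpr ⟨b, ?_, Finset.mem_image.mpr
      ⟨m - deg b, MvPolynomial.mem_support_iff.mpr hne, tsub_add_cancel_of_le h⟩⟩)
    rw [Finsupp.mem_support_iff]
    intro h0
    simp [h0] at hne
  · rfl

theorem monomial_smul_homogenize {a m : σ →₀ ℕ} (c : F) {x : B →₀ F}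
    (hx : x ∈ labelLevel F deg a) :
    MvPolynomial.monomial m c • homogenize deg a x = homogenize deg (m + a) (c • x) := by
  ext1 b
  rw [Finsupp.smul_apply, homogenize_apply, homogenize_apply, smul_eq_mul,
    MvPolynomial.monomial_mul, Finsupp.smul_apply, smul_eq_mul]
  by_cases h : x b = 0
  · simp [h]
  · rw [add_tsub_assoc_of_le ((mem_labelLevel deg).mp hx b h)]

theorem mem_freeDegree_iff_multiComponent (k : ℕ) (p : B →₀ MvPolynomial σ F) :
    p ∈ freeDegree (F := F) (fun b => (deg b).degree) k ↔
      ∀ m, multiComponent deg m p ≠ 0 → m.degree = k := by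
  classical
  constructor
  · intro h m hm
    obtain ⟨b, hb⟩ := Finsupp.ne_iff.mp hm
    rw [multiComponent_apply, Finsupp.zero_apply] at hb
    split_ifs at hb with hle
    · rw [← h b _ hb, ← map_add, tsub_add_cancel_of_le hle]
    · exact absurd rfl hb
  · intro h b m hm
    rw [← map_add]
    refine h _ fun h0 => hm ?_
    rw [← multiComponent_add_apply deg, h0, Finsupp.zero_apply]

end Homogenization

namespace Frame

variable {σ : Type v} {F : Type u} [Field F] {M : Set (σ →₀ ℕ)} (A : Frame σ F M)

theorem single_mem_labelLevel {B : Type*} (deg : B → σ →₀ ℕ) (b : B) (c : F) :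
    Finsupp.single b c ∈ labelLevel F deg (deg b) := by
  classical
  rw [mem_labelLevel]
  intro b' h
  rw [Finsupp.single_apply] at h
  split_ifs at h with hb
  · rw [hb]
  · exact absurd rfl h

/-- The differential of the multigraded free resolution supported on a frame. -/
noncomputable def polyD (n : ℕ) :
    (A.B (n + 1) →₀ MvPolynomial σ F) →ₗ[MvPolynomial σ F] (A.B n →₀ MvPolynomial σ F) :=
  Finsupp.linearCombination _ fun b =>
    homogenize (A.deg n) (A.deg (n + 1) b) (A.d n (Finsupp.single b 1))

theorem polyD_single (n : ℕ) (b : A.B (n + 1)) (m : σ →₀ ℕ) (c : F) :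
    A.polyD n (Finsupp.single b (MvPolynomial.monomial m c)) =
      homogenize (A.deg n) (m + A.deg (n + 1) b) (A.d n (Finsupp.single b c)) := by
  rw [polyD, Finsupp.linearCombination_single, monomial_smul_homogenize _ _
    (A.d_mem _ _ _ (single_mem_labelLevel _ b 1)), ← map_smul, Finsupp.smul_single_one]

/-- Taking multidegree components turns `polyD` into the differential of the frame, so exactness
over `S` reduces to linear algebra over `F` at each level. -/
theorem multiComponent_polyD (n : ℕ) (m : σ →₀ ℕ) (p : A.B (n + 1) →₀ MvPolynomial σ F) :
    multiComponent (A.deg n) m (A.polyD n p) =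
      A.d n (multiComponent (A.deg (n + 1)) m p) := by
  induction p using Finsupp.induction_linear with
  | zero => simp
  | add p q hp hq => simp only [map_add, hp, hq]
  | single b f =>
    induction f using MvPolynomial.induction_on' with
    | monomial m' c =>
      have h1 : Finsupp.single b (MvPolynomial.monomial m' c) =
          homogenize (A.deg (n + 1)) (m' + A.deg (n + 1) b) (Finsupp.single b c) := by
        rw [homogenize_single, add_tsub_cancel_right]
      have h2 : Finsupp.single b c ∈ labelLevel F (A.deg (n + 1)) (m' + A.deg (n + 1) b) := by
        rw [mem_labelLevel]
        exact fun b' h => ((mem_labelLevel _).mp (single_mem_labelLevel _ b c) b' h).trans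
          le_add_self
      rw [polyD_single]
      by_cases hm : m' + A.deg (n + 1) b = m
      · rw [h1, ← hm, multiComponent_homogenize _ h2,
          multiComponent_homogenize _ (A.d_mem _ _ _ h2)]
      · rw [h1, multiComponent_homogenize_of_ne _ hm h2, map_zero,
          multiComponent_homogenize_of_ne _ hm (A.d_mem _ _ _ h2)]
    | add f g hf hg => rw [Finsupp.single_add, map_add, map_add, hf, hg, map_add, map_add]

theorem exists_polyD_eq (n : ℕ) (p : A.B n →₀ MvPolynomial σ F)
    (h : ∀ m, ∃ y ∈ labelLevel F (A.deg (n + 1)) m, A.d n y = multiComponent (A.deg n) m p) :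
    ∃ q, A.polyD n q = p := by
  choose y hy hd using h
  obtain ⟨s, hs⟩ := finite_multiComponent_ne_zero (A.deg n) p
  refine ⟨∑ m ∈ s, homogenize (A.deg (n + 1)) m (y m),
    eq_of_multiComponent_eq (A.deg n) fun m => ?_⟩
  rw [multiComponent_polyD, map_sum]
  by_cases hm : m ∈ s
  · rw [Finset.sum_eq_single_of_mem m hm fun m' _ h => multiComponent_homogenize_of_ne _ h (hy m'),
      multiComponent_homogenize _ (hy m), hd]
  · rw [Finset.sum_eq_zero fun m' hm' => multiComponent_homogenize_of_ne _
      (fun h : m' = m => hm (h ▸ hm')) (hy m'), map_zero, hs m hm]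

variable {I : Ideal (MvPolynomial σ F)} (hI : ∀ p, p ∈ I ↔ ∀ m, MvPolynomial.coeff m p ≠ 0 → m ∈ M)

theorem multiComponent_zero_apply (m : σ →₀ ℕ) (p : A.B 0 →₀ MvPolynomial σ F) (b : A.B 0) :
    multiComponent (A.deg 0) m p b = MvPolynomial.coeff m (p b) := by
  have h := multiComponent_add_apply (A.deg 0) m p b
  rwa [A.deg_zero, add_zero] at h

/-- The graded free resolution supported on a frame. -/
noncomputable def toResolution : GradedFreeResolution I where
  B := A.B
  deg n b := (A.deg n b).degree
  d := A.polyD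
  aug := I.mkQ ∘ₗ Finsupp.lapply A.unique.default
  d_mem n k p hp := by
    rw [mem_freeDegree_iff_multiComponent] at hp ⊢
    intro m hm
    refine hp m fun h => hm ?_
    rw [multiComponent_polyD, h, map_zero]
  aug_mem k p hp := by
    refine ⟨p A.unique.default, fun m hm => ?_, rfl⟩
    have h := hp A.unique.default m hm
    simp only [A.deg_zero, map_zero, add_zero] at h
    rwa [Finsupp.degree_eq_weight_one] at h
  aug_surjective x := by
    obtain ⟨f, rfl⟩ := Submodule.mkQ_surjective I x
    exact ⟨Finsupp.single A.unique.default f, by simp⟩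
  exact_aug p := by
    have hp : (I.mkQ ∘ₗ Finsupp.lapply A.unique.default) p = 0 ↔ p A.unique.default ∈ I :=
      Submodule.Quotient.mk_eq_zero I
    rw [hp, hI]
    constructor
    · intro h
      refine A.exists_polyD_eq 0 p fun m => ?_
      by_cases hm : m ∈ M
      · exact A.exists_preimage m hm _
      · refine ⟨0, Submodule.zero_mem _, ?_⟩
        rw [map_zero]
        ext b
        rw [multiComponent_zero_apply, A.unique.uniq b]
        by_contra hne
        exact hm (h m fun h => hne h.symm)
    · rintro ⟨q, rfl⟩ m hm
      by_contra hM
      rw [← multiComponent_zero_apply, multiComponent_polyD,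
        A.d_zero m hM _ (multiComponent_mem _ m q)] at hm
      exact hm rfl
  exact_d n p := by
    constructor
    · intro h
      refine A.exists_polyD_eq (n + 1) p fun m => A.exact n m _ (multiComponent_mem _ m p) ?_
      rw [← multiComponent_polyD, h, map_zero]
    · rintro ⟨q, rfl⟩
      refine eq_of_multiComponent_eq (A.deg n) fun m => ?_
      rw [multiComponent_polyD, multiComponent_polyD, A.d_comp, map_zero]

/-- The entry of the differential at `b, b'` is a scalar times the monomial with exponent the
difference of the labels. If the scalar is nonzero, the label of `b'` divides that of `b`; as the
two differ, the monomial is not constant and acts as zero on the residue field. -/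
theorem tensD_toResolution (hA : ∀ n b b', A.deg (n + 1) b ≠ A.deg n b') (n : ℕ) :
    (A.toResolution hI).tensD n = 0 := by
  refine TensorProduct.ext (LinearMap.ext fun r => Finsupp.lhom_ext' fun b =>
    LinearMap.ext_ring ?_)
  change r ⊗ₜ[MvPolynomial σ F] A.polyD n (Finsupp.single b 1) = 0
  have h1 : A.polyD n (Finsupp.single b 1) =
      homogenize (A.deg n) (A.deg (n + 1) b) (A.d n (Finsupp.single b 1)) := by
    have h := A.polyD_single n b 0 1
    rwa [zero_add] at h
  rw [h1, ← Finsupp.sum_single (homogenize _ _ _), Finsupp.sum, TensorProduct.tmul_sum]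
  refine Finset.sum_eq_zero fun b' _ => ?_
  rw [← Finsupp.smul_single_one, TensorProduct.tmul_smul, TensorProduct.smul_tmul']
  obtain ⟨s, rfl⟩ := Ideal.Quotient.mk_surjective r
  rw [homogenize_apply]
  set x := A.d n (Finsupp.single b 1) with hx
  have h2 : MvPolynomial.constantCoeff
      (MvPolynomial.monomial (A.deg (n + 1) b - A.deg n b') (x b')) = 0 := by
    by_cases h0 : x b' = 0
    · rw [h0, map_zero, map_zero]
    · have hle := (mem_labelLevel _).mp (A.d_mem n _ _ (single_mem_labelLevel _ b 1)) b' h0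
      classical
      rw [MvPolynomial.constantCoeff_monomial, if_neg]
      -- The subtraction is truncated, so a zero difference gives only one inequality; `hle` is the
      -- other.
      exact fun h => hA n b b' (le_antisymm (tsub_eq_zero_iff_le.mp h) hle)
  have h3 : MvPolynomial.monomial (A.deg (n + 1) b - A.deg n b') (x b') •
      (Ideal.Quotient.mk (Ideal.span (Set.range (MvPolynomial.X : σ → MvPolynomial σ F)))) s =
      0 := by
    have h4 : (Ideal.Quotient.mk
        (Ideal.span (Set.range (MvPolynomial.X : σ → MvPolynomial σ F)))) s =
        s • (1 : ResidueField σ F) := by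
      rw [← Algebra.algebraMap_eq_smul_one]
      rfl
    rw [h4, smul_comm, smul_one_residueField, h2, map_zero, smul_zero]
  rw [h3, TensorProduct.zero_tmul]

theorem lsingle_comp_lapply_apply {R α β : Type*} [CommRing R] (a : α) (b : β) (p : α →₀ R) :
    (Finsupp.lsingle (R := R) b ∘ₗ Finsupp.lapply a) p b = p a :=
  Finsupp.single_eq_same

attribute [local instance] MvPolynomial.gradedAlgebra

/-- The graded Betti numbers count the basis elements of a minimal frame. -/
theorem gradedBetti_eq (hI : ∀ p, p ∈ I ↔ ∀ m, MvPolynomial.coeff m p ≠ 0 → m ∈ M)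
    (hI' : I.IsHomogeneous (MvPolynomial.homogeneousSubmodule σ F))
    (hA : ∀ n b b', A.deg (n + 1) b ≠ A.deg n b') (i k : ℕ) :
    gradedBetti I hI' i k = Cardinal.mk {b : A.B i // (A.deg i b).degree = k} := by
  let r := A.unique.default
  have hr : ∀ b, b = r := A.unique.uniq
  rw [gradedBetti, GradedFreeResolution.rank_torDegree_eq_rank_tensDegree _ (A.toResolution hI)
    (A.tensD_toResolution hI hA)
    -- In homological degree `0` both resolutions are `S` with its generator in degree `0`, and the
    -- comparison maps identify the two generators.
    (Finsupp.lsingle (M := MvPolynomial σ F) PUnit.unit ∘ₗ Finsupp.lapply r) ?_ ?_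
    (Finsupp.lsingle (M := MvPolynomial σ F) r ∘ₗ Finsupp.lapply PUnit.unit) ?_ ?_ i k]
  · exact GradedFreeResolution.rank_tensDegree _ i k
  · rintro k p hp ⟨⟩ m hm
    have h : m.degree + (A.deg 0 r).degree = k := hp r m fun h0 =>
      hm ((congrArg (MvPolynomial.coeff m) (lsingle_comp_lapply_apply r PUnit.unit p)).trans h0)
    rwa [A.deg_zero, map_zero] at h
  · exact fun p => congrArg I.mkQ (lsingle_comp_lapply_apply r PUnit.unit p)
  · intro k p hp b m hm
    have h : m.degree + 0 = k := hp PUnit.unit m fun h0 => hm (by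
      rw [hr b]
      exact (congrArg (MvPolynomial.coeff m)
        (lsingle_comp_lapply_apply PUnit.unit r p)).trans h0)
    have h2 : (A.deg 0 b).degree = 0 := (congrArg _ (A.deg_zero b)).trans (map_zero _)
    exact (congrArg (m.degree + ·) h2).trans h
  · exact fun p => congrArg I.mkQ (lsingle_comp_lapply_apply PUnit.unit r p)

end Frame

end GradedBetti

/-! ### Mapping cones: adjoining one monomial to a monomial ideal -/

namespace GradedBetti

section LabelLevel

variable {σ : Type*} {F : Type*} [Field F]

theorem map_mem_labelLevel {B C : Type*} (deg : B → σ →₀ ℕ) (deg' : C → σ →₀ ℕ) (u : σ →₀ ℕ)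
    (φ : (B →₀ F) →ₗ[F] (C →₀ F))
    (h : ∀ b, φ (Finsupp.single b 1) ∈ labelLevel F deg' (deg b + u)) (m : σ →₀ ℕ) (x : B →₀ F)
    (hx : x ∈ labelLevel F deg m) : φ x ∈ labelLevel F deg' (m + u) := by
  rw [← Finsupp.sum_single x, Finsupp.sum, map_sum]
  refine Submodule.sum_mem _ fun b hb => ?_
  rw [← Finsupp.smul_single_one, map_smul]
  refine Submodule.smul_mem _ _ ((mem_labelLevel _).mpr fun c hc => ?_)
  have hbm := (mem_labelLevel _).mp hx b (Finsupp.mem_support_iff.mp hb)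
  exact ((mem_labelLevel _).mp (h b) c hc).trans (add_le_add_left hbm u)

theorem mem_labelLevel_add {B : Type*} (deg : B → σ →₀ ℕ) (u m : σ →₀ ℕ) (x : B →₀ F) :
    x ∈ labelLevel F (fun b => deg b + u) (m + u) ↔ x ∈ labelLevel F deg m := by
  simp only [mem_labelLevel, add_le_add_iff_right]

theorem eq_zero_of_mem_labelLevel_add {B : Type*} (deg : B → σ →₀ ℕ) {u m : σ →₀ ℕ}
    (hm : ¬ u ≤ m) {x : B →₀ F} (hx : x ∈ labelLevel F (fun b => deg b + u) m) : x = 0 := by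
  ext b
  by_contra h
  exact hm (le_add_self.trans ((mem_labelLevel _).mp hx b h))

theorem mem_labelLevel_sumElim {B C : Type*} (deg : B → σ →₀ ℕ) (deg' : C → σ →₀ ℕ)
    (m : σ →₀ ℕ) (x : B ⊕ C →₀ F) :
    x ∈ labelLevel F (Sum.elim deg deg') m ↔
      (Finsupp.sumFinsuppLEquivProdFinsupp F x).1 ∈ labelLevel F deg m ∧
      (Finsupp.sumFinsuppLEquivProdFinsupp F x).2 ∈ labelLevel F deg' m := by
  simp [mem_labelLevel]

end LabelLevel

namespace Frame

variable {σ : Type v} {F : Type u} [Field F] {M N : Set (σ →₀ ℕ)}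

theorem mem_labelLevel_zero (A : Frame σ F M) (m : σ →₀ ℕ) (x : A.B 0 →₀ F) :
    x ∈ labelLevel F (A.deg 0) m := by
  rw [mem_labelLevel]
  intro b _
  rw [A.deg_zero]
  exact zero_le

/-- The isomorphism between the one-dimensional spaces of two frames in degree zero. -/
noncomputable def zeroEquiv (C : Frame σ F N) (A : Frame σ F M) :
    (C.B 0 →₀ F) ≃ₗ[F] (A.B 0 →₀ F) :=
  letI := A.unique
  letI := C.unique
  Finsupp.domLCongr (Equiv.ofUnique (C.B 0) (A.B 0))

/-- By `hu`, `N` is the exponent set of the colon ideal by the monomial `u`. The chain map lifts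
multiplication by `u` from `S/(I:u)(-u)` to `S/I`. -/
theorem exists_chainMap (A : Frame σ F M) (C : Frame σ F N) (u : σ →₀ ℕ)
    (hu : ∀ m, m ∈ N ↔ m + u ∈ M) :
    ∃ φ : ∀ n, (C.B n →₀ F) →ₗ[F] (A.B n →₀ F), φ 0 = (C.zeroEquiv A).toLinearMap ∧
      (∀ n m, ∀ x ∈ labelLevel F (C.deg n) m, φ n x ∈ labelLevel F (A.deg n) (m + u)) ∧
      ∀ n x, A.d n (φ (n + 1) x) = φ n (C.d n x) := by
  obtain ⟨φ, h0, h⟩ := exists_dependent_seq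
    (α := fun n => (C.B n →₀ F) →ₗ[F] (A.B n →₀ F))
    (fun n φ => (∀ m, ∀ x ∈ labelLevel F (C.deg n) m, φ x ∈ labelLevel F (A.deg n) (m + u)) ∧
      ∀ m, ∀ x ∈ labelLevel F (C.deg (n + 1)) m,
        ∃ y ∈ labelLevel F (A.deg (n + 1)) (m + u), A.d n y = φ (C.d n x))
    (fun n φ ψ => ∀ x, A.d n (ψ x) = φ (C.d n x)) (C.zeroEquiv A).toLinearMap
    ⟨fun m x _ => A.mem_labelLevel_zero _ _, fun m x hx => by
      by_cases hm : m ∈ N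
      · exact A.exists_preimage _ ((hu m).mp hm) _
      · exact ⟨0, Submodule.zero_mem _, by rw [C.d_zero m hm x hx, map_zero, map_zero]⟩⟩
    (by
      rintro n φ ⟨-, hφ⟩
      obtain ⟨ψ, hψ, hd⟩ := exists_finsupp_lift (A.d n) (φ ∘ₗ C.d n)
        (fun b => {y | y ∈ labelLevel F (A.deg (n + 1)) (C.deg (n + 1) b + u)}) (fun b =>
          hφ _ _ (single_mem_labelLevel _ b 1))
      have hd' : ∀ x, A.d n (ψ x) = φ (C.d n x) := LinearMap.congr_fun hd
      have hm := map_mem_labelLevel _ _ u ψ hψ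
      refine ⟨ψ, ⟨hm, fun m x hx => A.exact n _ _ (hm _ _ (C.d_mem _ _ _ hx)) ?_⟩, hd'⟩
      rw [hd', C.d_comp, map_zero])
  exact ⟨φ, h0, fun n => (h n).1.1, fun n => (h n).2⟩

section Cone

variable (A : Frame σ F M) (C : Frame σ F N) (u : σ →₀ ℕ)

/-- The basis of the mapping cone. -/
def coneB : ℕ → Type (max u v)
  | 0 => A.B 0
  | n + 1 => A.B (n + 1) ⊕ C.B n

/-- The labels of the mapping cone. -/
noncomputable def coneDeg : ∀ n, coneB A C n → (σ →₀ ℕ)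
  | 0 => A.deg 0
  | n + 1 => Sum.elim (A.deg (n + 1)) fun b => C.deg n b + u

variable (φ : ∀ n, (C.B n →₀ F) →ₗ[F] (A.B n →₀ F))

/-- The differential of the mapping cone. -/
noncomputable def coneD : ∀ n, (coneB A C (n + 1) →₀ F) →ₗ[F] (coneB A C n →₀ F)
  | 0 => (A.d 0).coprod (φ 0) ∘ₗ (Finsupp.sumFinsuppLEquivProdFinsupp F).toLinearMap
  | n + 1 => (Finsupp.sumFinsuppLEquivProdFinsupp F).symm.toLinearMap ∘ₗ
      (((A.d (n + 1)).coprod (φ (n + 1))).prod (-(C.d n) ∘ₗ LinearMap.snd F _ _)) ∘ₗ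
        (Finsupp.sumFinsuppLEquivProdFinsupp F).toLinearMap

/-- The splitting of the mapping cone. -/
noncomputable def coneSplit (n : ℕ) : (coneB A C (n + 1) →₀ F) ≃ₗ[F]
    (A.B (n + 1) →₀ F) × (C.B n →₀ F) :=
  Finsupp.sumFinsuppLEquivProdFinsupp F

theorem coneD_zero (x : coneB A C 1 →₀ F) :
    coneD A C φ 0 x = A.d 0 (coneSplit A C 0 x).1 + φ 0 (coneSplit A C 0 x).2 := rfl

theorem coneSplit_coneD (n : ℕ) (x : coneB A C (n + 2) →₀ F) :
    coneSplit A C n (coneD A C φ (n + 1) x) =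
      (A.d (n + 1) (coneSplit A C (n + 1) x).1 + φ (n + 1) (coneSplit A C (n + 1) x).2,
        -C.d n (coneSplit A C (n + 1) x).2) :=
  LinearEquiv.apply_symm_apply (Finsupp.sumFinsuppLEquivProdFinsupp F) _

theorem mem_labelLevel_coneDeg (n : ℕ) (m : σ →₀ ℕ) (x : coneB A C (n + 1) →₀ F) :
    x ∈ labelLevel F (coneDeg A C u (n + 1)) m ↔
      (coneSplit A C n x).1 ∈ labelLevel F (A.deg (n + 1)) m ∧
      (coneSplit A C n x).2 ∈ labelLevel F (fun b => C.deg n b + u) m :=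
  mem_labelLevel_sumElim _ _ _ _

/-- The mapping cone of the multiplication by a monomial is a frame. -/
noncomputable def cone {M' : Set (σ →₀ ℕ)} (hM' : ∀ m, m ∈ M' ↔ m ∈ M ∨ u ≤ m)
    (hu : ∀ m, m ∈ N ↔ m + u ∈ M) (h0 : φ 0 = (C.zeroEquiv A).toLinearMap)
    (hmem : ∀ n m, ∀ x ∈ labelLevel F (C.deg n) m, φ n x ∈ labelLevel F (A.deg n) (m + u))
    (hd : ∀ n x, A.d n (φ (n + 1) x) = φ n (C.d n x)) : Frame σ F M' where
  B := coneB A C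
  finite
    | 0 => A.finite 0
    | n + 1 =>
      letI := A.finite (n + 1)
      letI := C.finite n
      inferInstanceAs (Fintype (A.B (n + 1) ⊕ C.B n))
  unique := A.unique
  deg := coneDeg A C u
  deg_zero := A.deg_zero
  d := coneD A C φ
  d_mem n m x hx := by
    rw [mem_labelLevel_coneDeg] at hx
    obtain ⟨hx1, hx2⟩ := hx
    cases n with
    | zero => exact A.mem_labelLevel_zero _ _
    | succ n =>
      rw [mem_labelLevel_coneDeg, coneSplit_coneD]
      by_cases hm : u ≤ m
      · obtain ⟨m, rfl⟩ := exists_add_of_le hm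
        rw [add_comm u m] at hx1 hx2 ⊢
        rw [mem_labelLevel_add] at hx2
        exact ⟨Submodule.add_mem _ (A.d_mem _ _ _ hx1) (hmem _ _ _ hx2), (mem_labelLevel_add ..).mpr
          (Submodule.neg_mem _ (C.d_mem _ _ _ hx2))⟩
      · have h := eq_zero_of_mem_labelLevel_add _ hm hx2
        rw [h, map_zero, map_zero, add_zero, neg_zero]
        exact ⟨A.d_mem _ _ _ hx1, Submodule.zero_mem _⟩
  d_zero m hm x hx := by
    rw [hM', not_or] at hm
    rw [mem_labelLevel_coneDeg] at hx
    rw [coneD_zero, eq_zero_of_mem_labelLevel_add _ hm.2 hx.2, A.d_zero m hm.1 _ hx.1, map_zero]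
    exact add_zero (0 : A.B 0 →₀ F)
  exists_preimage m hm x := by
    by_cases hum : u ≤ m
    · obtain ⟨m, rfl⟩ := exists_add_of_le hum
      -- For `u ≤ m`, the degree-`0` generator of the shifted copy of `C` lies in level `m`, and `φ
      -- 0` maps it onto the generator of `A`.
      refine ⟨(coneSplit A C 0).symm (0, (C.zeroEquiv A).symm x), ?_, ?_⟩
      · rw [mem_labelLevel_coneDeg, LinearEquiv.apply_symm_apply, add_comm u m,
          mem_labelLevel_add]
        exact ⟨Submodule.zero_mem _, C.mem_labelLevel_zero _ _⟩
      · rw [coneD_zero, LinearEquiv.apply_symm_apply, h0, map_zero, zero_add]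
        exact LinearEquiv.apply_symm_apply _ _
    · obtain ⟨y, hy, hyx⟩ := A.exists_preimage m (((hM' m).mp hm).resolve_right hum) x
      refine ⟨(coneSplit A C 0).symm (y, 0), ?_, ?_⟩
      · rw [mem_labelLevel_coneDeg, LinearEquiv.apply_symm_apply]
        exact ⟨hy, Submodule.zero_mem _⟩
      · rw [coneD_zero, LinearEquiv.apply_symm_apply, map_zero, add_zero]
        exact hyx
  d_comp n x := by
    cases n with
    | zero =>
      rw [coneD_zero, coneSplit_coneD, map_add, A.d_comp, hd, map_neg, zero_add]
      exact add_neg_cancel (φ 0 (C.d 0 _))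
    | succ n =>
      apply (coneSplit A C n).injective
      rw [coneSplit_coneD, coneSplit_coneD, map_add, A.d_comp, hd, map_neg, map_neg, C.d_comp,
        zero_add, add_neg_cancel, neg_zero, neg_zero, map_zero]
      rfl
  exact n m x hx hx0 := by
    rw [mem_labelLevel_coneDeg] at hx
    obtain ⟨hx1, hx2⟩ := hx
    -- Once the `C`-component `q` of a cycle is bounded by `q'`, subtracting `φ q'` from the
    -- `A`-component leaves a cycle of `A`, which exactness bounds. If `u ≤ m` fails, level `m` of
    -- the shifted `C` is zero and only `A` matters.
    have key : ∀ (p : A.B (n + 1) →₀ F) (q : C.B n →₀ F),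
        p ∈ labelLevel F (A.deg (n + 1)) m → q ∈ labelLevel F (fun b => C.deg n b + u) m →
        A.d n p + φ n q = 0 →
        (u ≤ m → ∃ q' ∈ labelLevel F (fun b => C.deg (n + 1) b + u) m, -C.d n q' = q) →
        ∃ p' ∈ labelLevel F (A.deg (n + 2)) m,
        ∃ q' ∈ labelLevel F (fun b => C.deg (n + 1) b + u) m,
          A.d (n + 1) p' + φ (n + 1) q' = p ∧ -C.d n q' = q := by
      intro p q hp hq hpq hex
      by_cases hm : u ≤ m
      · obtain ⟨q', hq', rfl⟩ := hex hm
        obtain ⟨m, rfl⟩ := exists_add_of_le hm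
        rw [add_comm u m] at *
        have hq2 := hq'
        rw [mem_labelLevel_add] at hq2
        obtain ⟨p', hp', hpp⟩ := A.exact n _ (p - φ (n + 1) q')
          (Submodule.sub_mem _ hp (hmem _ _ _ hq2))
          (by rw [map_sub, hd]; rwa [map_neg, ← sub_eq_add_neg] at hpq)
        exact ⟨p', hp', q', hq', by rw [hpp, sub_add_cancel], rfl⟩
      · have hq0 := eq_zero_of_mem_labelLevel_add _ hm hq
        rw [hq0, map_zero, add_zero] at hpq
        obtain ⟨p', hp', hpp⟩ := A.exact n _ p hp hpq
        exact ⟨p', hp', 0, Submodule.zero_mem _, by rw [hpp, map_zero, add_zero],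
          by rw [hq0, map_zero, neg_zero]⟩
    have fin : ∀ p q, (p ∈ labelLevel F (A.deg (n + 2)) m) →
        q ∈ labelLevel F (fun b => C.deg (n + 1) b + u) m →
        A.d (n + 1) p + φ (n + 1) q = (coneSplit A C n x).1 →
        -C.d n q = (coneSplit A C n x).2 →
        ∃ y ∈ labelLevel F (coneDeg A C u (n + 2)) m, coneD A C φ (n + 1) y = x := by
      intro p q hp hq h1 h2
      refine ⟨(coneSplit A C (n + 1)).symm (p, q), ?_, (coneSplit A C n).injective ?_⟩
      · rw [mem_labelLevel_coneDeg, LinearEquiv.apply_symm_apply]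
        exact ⟨hp, hq⟩
      · rw [coneSplit_coneD, LinearEquiv.apply_symm_apply]
        exact Prod.ext h1 h2
    obtain ⟨p', hp', q', hq', h1, h2⟩ := key _ _ hx1 hx2 (by
        cases n with
        | zero => exact hx0
        | succ n =>
          have h := coneSplit_coneD A C φ n x
          rw [hx0, map_zero] at h
          exact (congrArg Prod.fst h).symm) (fun hm => by
        obtain ⟨m, rfl⟩ := exists_add_of_le hm
        rw [add_comm u m, mem_labelLevel_add] at *
        cases n with
        | zero =>
          by_cases hN : m ∈ N
          · obtain ⟨y, hy, h⟩ := C.exists_preimage m hN (coneSplit A C 0 x).2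
            exact ⟨-y, (mem_labelLevel_add ..).mpr (Submodule.neg_mem _ hy),
              by rw [map_neg, neg_neg, h]⟩
          -- Outside `N` the differential of `A` vanishes at level `m + u`, so the cycle condition
          -- reads `φ 0 q = 0`, and `q = 0` because `φ 0` is an isomorphism.
          · refine ⟨0, Submodule.zero_mem _, ?_⟩
            rw [coneD_zero, A.d_zero _ (fun h => hN ((hu m).mpr h)) _ hx1, zero_add, h0] at hx0
            rw [map_zero, neg_zero]
            exact ((LinearEquiv.map_eq_zero_iff _).mp hx0).symm
        | succ n =>
          have h := coneSplit_coneD A C φ n x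
          rw [hx0, map_zero] at h
          obtain ⟨y, hy, hyx⟩ := C.exact n m _ hx2 (neg_eq_zero.mp (congrArg Prod.snd h).symm)
          exact ⟨-y, (mem_labelLevel_add ..).mpr (Submodule.neg_mem _ hy),
            by rw [map_neg, neg_neg, hyx]⟩)
    exact fin p' q' hp' hq' h1 h2

end Cone

open Polynomial in
/-- The generating function of the basis elements: the coefficient of `t ^ n * X ^ k` counts the
basis elements of homological degree `n` with labels of degree `k`. -/
noncomputable def genFun (A : Frame σ F M) : PowerSeries (Polynomial ℕ) :=
  PowerSeries.mk fun n => letI := A.finite n; ∑ b : A.B n, (X : Polynomial ℕ) ^ (A.deg n b).degree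

theorem card_eq_coeff_genFun (A : Frame σ F M) (n k : ℕ) :
    Cardinal.mk {b : A.B n // (A.deg n b).degree = k} =
      (((PowerSeries.coeff n A.genFun).coeff k : ℕ) : Cardinal) := by
  classical
  let := A.finite n
  rw [Cardinal.mk_fintype, genFun, PowerSeries.coeff_mk, Polynomial.finsetSum_coeff]
  simp only [Polynomial.coeff_X_pow, Finset.sum_boole, Fintype.card_subtype, Nat.cast_id,
    eq_comm (a := k)]

end Frame

/-- The monomial ideal with exponent set `M` has a frame whose labels in homological degree `n`
satisfy `G n`, with generating function `p`. -/
def HasFrame (F : Type u) [Field F] {σ : Type v} (M : Set (σ →₀ ℕ)) (G : ℕ → (σ →₀ ℕ) → Prop)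
    (p : PowerSeries (Polynomial ℕ)) : Prop :=
  ∃ A : Frame σ F M, (∀ n b, G n (A.deg n b)) ∧ A.genFun = p

section HasFrame

variable {F : Type u} [Field F] {σ : Type v}

/-- The factors `X` and `C (X ^ u.degree)` record the shift of the second frame by one homological
degree and by the label `u`. -/
theorem HasFrame.cone {M N M' : Set (σ →₀ ℕ)} {G H G' : ℕ → (σ →₀ ℕ) → Prop}
    {p q : PowerSeries (Polynomial ℕ)} (hA : HasFrame F M G p) (hC : HasFrame F N H q)
    (u : σ →₀ ℕ) (hM' : ∀ m, m ∈ M' ↔ m ∈ M ∨ u ≤ m) (hu : ∀ m, m ∈ N ↔ m + u ∈ M)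
    (hG : ∀ n m, G n m → G' n m) (hH : ∀ n m, H n m → G' (n + 1) (m + u)) :
    HasFrame F M' G' (p + PowerSeries.X * PowerSeries.C (Polynomial.X ^ u.degree) * q) := by
  obtain ⟨A, hA, rfl⟩ := hA
  obtain ⟨C, hC, rfl⟩ := hC
  obtain ⟨φ, h0, hmem, hd⟩ := A.exists_chainMap C u hu
  refine ⟨A.cone C u φ hM' hu h0 hmem hd, ?_, ?_⟩
  · rintro (_ | n) b
    · exact hG _ _ (hA 0 b)
    · rcases b with b | b
      · exact hG _ _ (hA (n + 1) b)
      · exact hH _ _ (hC n b)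
  · ext1 n
    rw [map_add, mul_assoc]
    cases n with
    | zero =>
      rw [PowerSeries.coeff_zero_X_mul, add_zero, Frame.genFun, Frame.genFun, PowerSeries.coeff_mk,
        PowerSeries.coeff_mk]
      rfl
    | succ n =>
      rw [PowerSeries.coeff_succ_X_mul, PowerSeries.coeff_C_mul]
      let := A.finite (n + 1)
      let := C.finite n
      simp only [Frame.genFun, PowerSeries.coeff_mk]
      refine (Fintype.sum_sum_type (α₁ := A.B (n + 1)) (α₂ := C.B n) _).trans ?_
      congr 1
      rw [Finset.mul_sum]
      refine Finset.sum_congr rfl fun b _ => ?_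
      rw [← pow_add, ← map_add, add_comm u]
      rfl

/-- The frame of the zero ideal. -/
noncomputable def Frame.zeroIdeal (σ : Type v) (F : Type u) [Field F] :
    Frame σ F (∅ : Set (σ →₀ ℕ)) where
  B
    | 0 => PUnit
    | _ + 1 => PEmpty
  finite
    | 0 => inferInstanceAs (Fintype PUnit)
    | _ + 1 => inferInstanceAs (Fintype PEmpty)
  unique := inferInstanceAs (Unique PUnit)
  deg _ _ := 0
  deg_zero _ := rfl
  d _ := 0
  d_mem _ _ _ _ := Submodule.zero_mem _
  d_zero _ _ _ _ := rfl
  exists_preimage _ h := h.elim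
  d_comp _ _ := rfl
  exact _ _ _ _ _ := ⟨0, Submodule.zero_mem _, Finsupp.ext fun b => PEmpty.elim b⟩

theorem hasFrame_empty (G : ℕ → (σ →₀ ℕ) → Prop) (hG : G 0 0) :
    HasFrame F (∅ : Set (σ →₀ ℕ)) G 1 := by
  refine ⟨Frame.zeroIdeal σ F, ?_, ?_⟩
  · rintro (_ | n) b
    · exact hG
    · exact PEmpty.elim b
  · ext1 n
    rw [Frame.genFun, PowerSeries.coeff_mk, PowerSeries.coeff_one]
    cases n with
    | zero =>
      refine (Fintype.sum_unique (ι := PUnit) _).trans ?_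
      rw [if_pos rfl]
      exact (congrArg _ (map_zero _)).trans (pow_zero _)
    | succ n => exact Fintype.sum_empty (ι := PEmpty) _

end HasFrame

end GradedBetti

/-! ### Generating functions and compositions -/

namespace GradedBetti

section Series

open Polynomial

/-- The generating function of the positive part of the Betti numbers of `n` points. -/
noncomputable def pointSeries (n : ℕ) : PowerSeries (Polynomial ℕ) :=
  PowerSeries.mk fun i => monomial (i + 1) (i * n.choose (i + 1))

theorem coeff_one_add_pow (k i : ℕ) :
    PowerSeries.coeff i
      ((1 + PowerSeries.X * PowerSeries.C (X : Polynomial ℕ)) ^ k : PowerSeries (Polynomial ℕ)) =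
      monomial i (k.choose i) := by
  induction k generalizing i with
  | zero =>
    rw [pow_zero, PowerSeries.coeff_one]
    cases i <;> simp
  | succ k ih =>
    rw [pow_succ', add_mul, one_mul, map_add, ih, mul_assoc]
    cases i with
    | zero => rw [PowerSeries.coeff_zero_X_mul, add_zero, Nat.choose_zero_right,
        Nat.choose_zero_right]
    | succ i =>
      rw [PowerSeries.coeff_succ_X_mul, PowerSeries.coeff_C_mul, ih, X_mul_monomial,
        ← map_add, Nat.choose_succ_succ', add_comm (k.choose i)]

theorem pointSeries_zero : pointSeries 0 = 0 := by
  ext1 i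
  simp [pointSeries]

/-- Pascal's rule together with `(i+1) * choose n (i+1) = n * choose (n-1) i`. The truncated `n - 1`
is harmless at `n = 0`, where the factor `n` vanishes. -/
theorem pointSeries_succ (n : ℕ) :
    pointSeries (n + 1) = pointSeries n + n •
      (PowerSeries.X * PowerSeries.C (X ^ 2 : Polynomial ℕ) *
        (1 + PowerSeries.X * PowerSeries.C (X : Polynomial ℕ)) ^ (n - 1)) := by
  ext1 i
  rw [map_add, map_nsmul, mul_assoc, pointSeries, pointSeries, PowerSeries.coeff_mk,
    PowerSeries.coeff_mk]
  cases i with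
  | zero => simp
  | succ i =>
    rw [PowerSeries.coeff_succ_X_mul, PowerSeries.coeff_C_mul, coeff_one_add_pow,
      X_pow_mul_monomial, ← map_nsmul, ← map_add, add_right_comm i 1 1]
    congr 1
    rw [Nat.choose_succ_succ' n (i + 1), smul_eq_mul]
    cases n with
    | zero => simp
    | succ n =>
      rw [Nat.add_sub_cancel, Nat.add_one_mul_choose_eq]
      ring

theorem coeff_prod_pointSeries {ι : Type} [DecidableEq ι] (I : Finset ι) (f : ι → ℕ) (i : ℕ) :
    PowerSeries.coeff i (∏ l ∈ I, pointSeries (f l)) =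
      monomial (i + I.card)
        (∑ c ∈ compositionsOn I i, ∏ l ∈ I, c l * (f l).choose (c l + 1)) := by
  rw [PowerSeries.coeff_prod, map_sum, compositionsOn, Finset.sum_filter]
  refine Finset.sum_bij (fun c _ => ⇑c) (fun c hc => ?_) (fun _ _ _ _ h => DFunLike.coe_injective h)
    (fun c hc => ?_) (fun c hc => ?_)
  · rw [Finset.mem_finsuppAntidiag] at hc
    exact Finset.mem_piAntidiag.mpr ⟨hc.1, fun l hl => hc.2 (Finsupp.mem_support_iff.mpr hl)⟩
  · rw [Finset.mem_piAntidiag] at hc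
    refine ⟨Finsupp.onFinset I c hc.2, ?_, rfl⟩
    exact Finset.mem_finsuppAntidiag.mpr ⟨hc.1, Finsupp.support_onFinset_subset⟩
  · rw [Finset.mem_finsuppAntidiag] at hc
    have h1 : ∀ l ∈ I, PowerSeries.coeff (c l) (pointSeries (f l)) =
        C (c l * (f l).choose (c l + 1)) * X ^ (c l + 1) := fun l _ => by
      rw [pointSeries, PowerSeries.coeff_mk, C_mul_X_pow_eq_monomial]
    rw [Finset.prod_congr rfl h1, Finset.prod_mul_distrib, ← map_prod, Finset.prod_pow_eq_pow_sum,
      Finset.sum_add_distrib, hc.1, ← Finset.card_eq_sum_ones, C_mul_X_pow_eq_monomial]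
    split_ifs with h
    · rfl
    -- An index with `c l = 0` kills the product, so the restriction to positive parts loses
    -- nothing.
    · push Not at h
      obtain ⟨l, hl, hl0⟩ := h
      rw [Finset.prod_eq_zero hl (by rw [Nat.lt_one_iff.mp hl0, zero_mul]), map_zero]

/-- In the expansion over subsets `I`, the coefficient of `t^i` is a multiple of `X^(i+|I|)`;
extracting `X^(i+j)` selects the subsets with `j` elements. -/
theorem coeff_prod_one_add_pointSeries {ι : Type} [DecidableEq ι] [Fintype ι] (f : ι → ℕ)
    (i j : ℕ) :
    (PowerSeries.coeff i (∏ l, (1 + pointSeries (f l)))).coeff (i + j) =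
      ∑ I ∈ Finset.powersetCard j (Finset.univ : Finset ι),
        ∑ c ∈ compositionsOn I i, ∏ l ∈ I, c l * (f l).choose (c l + 1) := by
  rw [Finset.prod_one_add, map_sum, Polynomial.finsetSum_coeff, Finset.powersetCard_eq_filter,
    Finset.sum_filter]
  refine Finset.sum_congr rfl fun I _ => ?_
  rw [coeff_prod_pointSeries, coeff_monomial]
  simp only [add_right_inj]

/-- Both sums are coefficients of the same power of `pointSeries k`. -/
theorem sum_compositionsOn_congr {ι κ : Type} [DecidableEq ι] [DecidableEq κ] (I : Finset ι)
    (J : Finset κ) (h : I.card = J.card) (i k : ℕ) :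
    ∑ c ∈ compositionsOn I i, ∏ l ∈ I, c l * k.choose (c l + 1) =
      ∑ c ∈ compositionsOn J i, ∏ l ∈ J, c l * k.choose (c l + 1) := by
  have h1 := coeff_prod_pointSeries I (fun _ => k) i
  have h2 := coeff_prod_pointSeries J (fun _ => k) i
  rw [Finset.prod_const, h, ← Finset.prod_const, h2] at h1
  exact (monomial_injective _ h1).symm

end Series

/-! ### Adjoining the generators colour by colour -/

section Coloring

variable {F : Type u} [Field F] {σ : Type v} {ι : Type*} (c : σ → ι)

theorem HasFrame.congr {M N : Set (σ →₀ ℕ)} {G H : ℕ → (σ →₀ ℕ) → Prop}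
    {p q : PowerSeries (Polynomial ℕ)} (h : HasFrame F M G p) (hM : M = N)
    (hG : ∀ n m, G n m → H n m) (hp : p = q) : HasFrame F N H q := by
  subst hM hp
  obtain ⟨A, hA, h⟩ := h
  exact ⟨A, fun n b => hG _ _ (hA n b), h⟩

/-- The exponents of the monomials divisible by two different variables of the same color
in `A`. -/
def mixedSet (A : Finset ι) : Set (σ →₀ ℕ) :=
  {m | ∃ v w, v ≠ w ∧ c v = c w ∧ c v ∈ A ∧ m v ≠ 0 ∧ m w ≠ 0}

/-- The exponents of the monomials divisible by two different variables in `T`. -/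
def pairSet (T : Finset σ) : Set (σ →₀ ℕ) :=
  {m | ∃ v ∈ T, ∃ w ∈ T, v ≠ w ∧ m v ≠ 0 ∧ m w ≠ 0}

/-- The exponents of the monomials divisible by a variable in `T`. -/
def variableSet (T : Finset σ) : Set (σ →₀ ℕ) :=
  {m | ∃ v ∈ T, m v ≠ 0}

theorem add_single_apply_of_ne {m : σ →₀ ℕ} {v w : σ} (h : v ≠ w) (k : ℕ) :
    (m + Finsupp.single v k) w = m w := by
  rw [Finsupp.add_apply, Finsupp.single_apply_eq_zero.mpr fun h' => absurd h'.symm h, add_zero]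

theorem single_one_le_iff {m : σ →₀ ℕ} {v : σ} : Finsupp.single v 1 ≤ m ↔ m v ≠ 0 := by
  rw [Finsupp.single_le_iff, Nat.one_le_iff_ne_zero]

theorem add_single_mem_mixedSet_iff {c : σ → ι} {A : Finset ι} {v : σ} (hv : c v ∉ A) (m : σ →₀ ℕ) :
    m + Finsupp.single v 1 ∈ mixedSet c A ↔ m ∈ mixedSet c A := by
  refine exists_congr fun a => exists_congr fun b => and_congr_right fun _ =>
    and_congr_right fun hab => and_congr_right fun ha => ?_
  rw [add_single_apply_of_ne (fun h : v = a => hv (h ▸ ha)),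
    add_single_apply_of_ne (fun h : v = b => hv (h ▸ hab ▸ ha))]

variable [Fintype σ] [DecidableEq ι]

/-- The degree of a monomial in the variables of color `l`. -/
def colorDeg (l : ι) (m : σ →₀ ℕ) : ℕ := ∑ v with c v = l, m v

theorem colorDeg_add (l : ι) (m m' : σ →₀ ℕ) :
    colorDeg c l (m + m') = colorDeg c l m + colorDeg c l m' :=
  Finset.sum_add_distrib

theorem colorDeg_single (l : ι) (v : σ) :
    colorDeg c l (Finsupp.single v 1) = if c v = l then 1 else 0 := by
  classical
  simp [colorDeg, Finsupp.single_apply]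

theorem colorDeg_eq_zero {l : ι} {m : σ →₀ ℕ} (h : ∀ v, c v = l → m v = 0) :
    colorDeg c l m = 0 :=
  Finset.sum_eq_zero fun v hv => h v (Finset.mem_filter.mp hv).2

/-- The homological degree of the labels in a resolution of the ideal of `mixedSet c A`. -/
def reducedDeg (A : Finset ι) (m : σ →₀ ℕ) : ℕ := ∑ l ∈ A, (colorDeg c l m - 1)

/-- The labels in the resolution of the ideal of `mixedSet c A`. -/
def MixedLabel (A : Finset ι) (n : ℕ) (m : σ →₀ ℕ) : Prop :=
  reducedDeg c A m = n ∧ ∀ v, c v ∉ A → m v = 0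

/-- The labels after adjoining variables of color `l` to the ideal of `mixedSet c A`. -/
def KoszulLabel (A : Finset ι) (l : ι) (n : ℕ) (m : σ →₀ ℕ) : Prop :=
  reducedDeg c A m + colorDeg c l m = n ∧ ∀ v, c v ∉ insert l A → m v = 0

variable {c} {A : Finset ι} {l : ι}

theorem reducedDeg_add_single {v : σ} (hv : c v ∉ A) (m : σ →₀ ℕ) :
    reducedDeg c A (m + Finsupp.single v 1) = reducedDeg c A m := by
  refine Finset.sum_congr rfl fun k hk => ?_
  rw [colorDeg_add, colorDeg_single, if_neg fun h : c v = k => hv (h ▸ hk), add_zero]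

/-- A variable `v` whose colour is not in `A` and which is not in `T` is a nonzerodivisor modulo the
current ideal. The colon ideal is thus the ideal itself, and the cone of two copies of its frame
contributes a factor `1 + tX`. -/
theorem hasFrame_adjoin_variables {p : PowerSeries (Polynomial ℕ)}
    (hp : HasFrame F (mixedSet c A) (MixedLabel c A) p) (hl : l ∉ A) (T : Finset σ)
    (hT : ∀ v ∈ T, c v = l) :
    HasFrame F (mixedSet c A ∪ variableSet T) (KoszulLabel c A l)
      (p * (1 + PowerSeries.X * PowerSeries.C Polynomial.X) ^ T.card) := by
  classical
  induction T using Finset.induction_on with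
  | empty =>
    refine hp.congr (by simp [variableSet]) ?_ (by simp)
    rintro n m ⟨h1, h2⟩
    refine ⟨?_, fun v hv => h2 v fun h => hv (Finset.mem_insert_of_mem h)⟩
    rw [colorDeg_eq_zero c (fun v hv => h2 v (hv ▸ hl)), h1, add_zero]
  | insert v T hvT ih =>
    have hv : c v = l := hT v (Finset.mem_insert_self v T)
    have ih := ih fun w hw => hT w (Finset.mem_insert_of_mem hw)
    have hvA : c v ∉ A := hv ▸ hl
    refine (HasFrame.cone (M' := mixedSet c A ∪ variableSet (insert v T))
      (G' := KoszulLabel c A l) ih ih (Finsupp.single v 1) (fun m => ?_)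
      (fun m => ?_) (fun _ _ h => h) ?_).congr rfl (fun _ _ h => h) ?_
    · simp only [Set.mem_union, variableSet, Set.mem_ofPred_eq, single_one_le_iff,
        Finset.exists_mem_insert]
      generalize (∃ x ∈ T, m x ≠ 0) = E
      tauto
    · refine or_congr (add_single_mem_mixedSet_iff hvA m).symm
        (exists_congr fun w => and_congr_right fun hw => ?_)
      rw [add_single_apply_of_ne (fun h : v = w => hvT (h ▸ hw))]
    · rintro n m ⟨h1, h2⟩
      refine ⟨?_, fun w hw => ?_⟩
      · rw [reducedDeg_add_single hvA, colorDeg_add, colorDeg_single, if_pos hv, ← add_assoc, h1]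
      · rw [add_single_apply_of_ne (fun h => hw ?_), h2 w hw]
        rw [← h, hv]
        exact Finset.mem_insert_self l A
    · rw [Finset.card_insert_of_notMem hvT, Finsupp.degree_single, pow_one]
      ring

/-- If the degree in colour `l` is `a`, then after multiplication by `vw` its reduced value is `(a +
2) - 1 = a + 1`. This matches the homological shift by one, even for `a = 0`. -/
theorem mixedLabel_add {n : ℕ} {m : σ →₀ ℕ} (hl : l ∉ A) {v w : σ} (hv : c v = l) (hw : c w = l)
    (h : KoszulLabel c A l n m) :
    MixedLabel c (insert l A) (n + 1) (m + (Finsupp.single v 1 + Finsupp.single w 1)) := by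
  obtain ⟨h1, h2⟩ := h
  constructor
  · rw [reducedDeg, Finset.sum_insert hl, ← add_assoc, colorDeg_add, colorDeg_add,
      colorDeg_single, colorDeg_single, if_pos hv, if_pos hw]
    change _ + reducedDeg c A _ = _
    rw [reducedDeg_add_single (hw ▸ hl), reducedDeg_add_single (hv ▸ hl)]
    omega
  · intro x hx
    have hne : ∀ y, c y = l → y ≠ x := by
      rintro y hy rfl
      exact hx (hy ▸ Finset.mem_insert_self _ _)
    rw [← add_assoc, add_single_apply_of_ne (hne w hw), add_single_apply_of_ne (hne v hv), h2 x hx]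

/-- For `v ∈ T \ U`, the colon ideal by `vw` is generated by the ideal of `A` and `T \ {v}`: each
such `x` satisfies `xv ∈ pairSet T`, and `U` gives nothing new because it lies in `T \ {v}`. The
colon ideal has the same generating function for every `v`, hence the multiple `U.card`. -/
theorem hasFrame_adjoin_products [DecidableEq σ] {p q : PowerSeries (Polynomial ℕ)}
    (hp : HasFrame F (mixedSet c A) (MixedLabel c A) p) (hl : l ∉ A) (T : Finset σ)
    (hT : ∀ v ∈ T, c v = l) {w : σ} (hw : c w = l) (hwT : w ∉ T)
    (hq : HasFrame F (mixedSet c A ∪ pairSet T) (MixedLabel c (insert l A)) q)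
    (U : Finset σ) (hU : U ⊆ T) :
    HasFrame F (mixedSet c A ∪ pairSet T ∪ {m | m w ≠ 0 ∧ m ∈ variableSet U})
      (MixedLabel c (insert l A))
      (q + U.card • (PowerSeries.X * PowerSeries.C (Polynomial.X ^ 2) *
        (p * (1 + PowerSeries.X * PowerSeries.C Polynomial.X) ^ (T.card - 1)))) := by
  induction U using Finset.induction_on with
  | empty => exact hq.congr (by simp [variableSet]) (fun _ _ h => h) (by simp)
  | insert v U hvU ih =>
    have ih := ih ((Finset.subset_insert v U).trans hU)
    have hvT : v ∈ T := hU (Finset.mem_insert_self v U)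
    have hv : c v = l := hT v hvT
    have hvw : v ≠ w := fun h => hwT (h ▸ hvT)
    have hK := hasFrame_adjoin_variables hp hl (T.erase v)
      (fun x hx => hT x (Finset.mem_of_mem_erase hx))
    obtain ⟨u, hu⟩ : ∃ u : σ →₀ ℕ, u = Finsupp.single v 1 + Finsupp.single w 1 := ⟨_, rfl⟩
    refine (HasFrame.cone
      (M' := mixedSet c A ∪ pairSet T ∪ {m | m w ≠ 0 ∧ m ∈ variableSet (insert v U)})
      (G' := MixedLabel c (insert l A)) ih hK u (fun m => ?_) (fun m => ?_)
      (fun _ _ h => h) (fun n m => hu ▸ mixedLabel_add hl hv hw)).congr rfl (fun _ _ h => h) ?_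
    · have hle : u ≤ m ↔ m v ≠ 0 ∧ m w ≠ 0 := by
        rw [hu]
        constructor
        · intro h
          exact ⟨single_one_le_iff.mp (le_self_add.trans h),
            single_one_le_iff.mp (le_add_self.trans h)⟩
        · rintro ⟨h1, h2⟩ x
          rw [Finsupp.add_apply, Finsupp.single_apply, Finsupp.single_apply]
          split_ifs with h3 h4 h4
          · exact absurd (h3.trans h4.symm) hvw
          · rw [← h3]; omega
          · rw [← h4]; omega
          · omega
      simp only [Set.mem_union, Set.mem_ofPred_eq, hle, variableSet, Finset.exists_mem_insert]
      generalize (∃ x ∈ U, m x ≠ 0) = E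
      tauto
    · have hmw : (m + u) w ≠ 0 := by simp [hu]
      have hmv : (m + u) v ≠ 0 := by simp [hu]
      have hm : ∀ x ∈ T, x ≠ v → (m + u) x = m x := by
        intro x hx hxv
        rw [hu, ← add_assoc, add_single_apply_of_ne (fun h : w = x => hwT (h ▸ hx)),
          add_single_apply_of_ne hxv.symm]
      have hmix : m + u ∈ mixedSet c A ↔ m ∈ mixedSet c A := by
        rw [hu, ← add_assoc, add_single_mem_mixedSet_iff (hw ▸ hl),
          add_single_mem_mixedSet_iff (hv ▸ hl)]
      constructor
      · rintro (h | ⟨x, hx, hmx⟩)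
        · exact Or.inl (Or.inl (hmix.mpr h))
        · obtain ⟨hxv, hxT⟩ := Finset.mem_erase.mp hx
          exact Or.inl (Or.inr ⟨x, hxT, v, hvT, hxv, by rwa [hm x hxT hxv], hmv⟩)
      -- Every generator of the ideal that is not of an earlier colour involves a variable of `T`
      -- other than `v`, and multiplication by `u` does not change its exponent.
      · have aux : ∀ x ∈ T, x ≠ v → (m + u) x ≠ 0 →
            m ∈ mixedSet c A ∪ variableSet (T.erase v) := by
          intro x hx hxv h
          exact Or.inr ⟨x, Finset.mem_erase.mpr ⟨hxv, hx⟩, by rwa [hm x hx hxv] at h⟩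
        rintro ((h | ⟨x, hx, y, hy, hxy, h1, h2⟩) | ⟨-, x, hx, h⟩)
        · exact Or.inl (hmix.mp h)
        · by_cases hxv : x = v
          · exact aux y hy (fun h => hxy (hxv.trans h.symm)) h2
          · exact aux x hx hxv h1
        · exact aux x (hU (Finset.mem_insert_of_mem hx)) (fun h => hvU (h ▸ hx)) h
    · rw [Finset.card_insert_of_notMem hvU, Finset.card_erase_of_mem hvT, hu, map_add,
        Finsupp.degree_single, Finsupp.degree_single, add_smul, one_smul, add_assoc]

/-- The pairs in `insert w T` are the pairs in `T` and the products of `w` with all of `T`, so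
`hasFrame_adjoin_products` with `U = T` realises the recursion `pointSeries_succ`. -/
theorem hasFrame_adjoin_pairs {p : PowerSeries (Polynomial ℕ)}
    (hp : HasFrame F (mixedSet c A) (MixedLabel c A) p) (hl : l ∉ A) (T : Finset σ)
    (hT : ∀ v ∈ T, c v = l) :
    HasFrame F (mixedSet c A ∪ pairSet T) (MixedLabel c (insert l A))
      (p * (1 + pointSeries T.card)) := by
  classical
  induction T using Finset.induction_on with
  | empty =>
    refine hp.congr (by simp [pairSet]) ?_ (by simp [pointSeries_zero])
    rintro n m ⟨h1, h2⟩
    refine ⟨?_, fun v hv => h2 v fun h => hv (Finset.mem_insert_of_mem h)⟩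
    rw [reducedDeg, Finset.sum_insert hl, colorDeg_eq_zero c (fun v hv => h2 v (hv ▸ hl)),
      Nat.zero_sub, zero_add]
    exact h1
  | insert w T hwT ih =>
    have hT' : ∀ v ∈ T, c v = l := fun v hv => hT v (Finset.mem_insert_of_mem hv)
    refine (hasFrame_adjoin_products hp hl T hT' (hT w (Finset.mem_insert_self w T)) hwT
      (ih hT') T Finset.Subset.rfl).congr ?_ (fun _ _ h => h) ?_
    · ext m
      simp only [Set.mem_union, Set.mem_ofPred_eq, pairSet, variableSet,
        Finset.exists_mem_insert]
      constructor
      · rintro ((h | ⟨a, ha, b, hb, h⟩) | ⟨h, a, ha, h'⟩)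
        · exact Or.inl h
        · exact Or.inr (Or.inr ⟨a, ha, Or.inr ⟨b, hb, h⟩⟩)
        · exact Or.inr (Or.inl (Or.inr ⟨a, ha, fun h => hwT (h ▸ ha), h, h'⟩))
      · rintro (h | (⟨h, -⟩ | ⟨a, ha, -, h, h'⟩) | ⟨a, ha, ⟨-, h, h'⟩ | ⟨b, hb, h⟩⟩)
        · exact Or.inl (Or.inl h)
        · exact absurd rfl h
        · exact Or.inr ⟨h, a, ha, h'⟩
        · exact Or.inr ⟨h', a, ha, h⟩
        · exact Or.inl (Or.inr ⟨a, ha, b, hb, h⟩)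
    · rw [Finset.card_insert_of_notMem hwT, pointSeries_succ]
      simp only [nsmul_eq_mul]
      ring

theorem hasFrame_mixedSet (A : Finset ι) :
    HasFrame F (mixedSet c A) (MixedLabel c A)
      (∏ l ∈ A, (1 + pointSeries (Finset.univ.filter fun v => c v = l).card)) := by
  induction A using Finset.induction_on with
  | empty =>
    refine (hasFrame_empty (MixedLabel c ∅) ⟨rfl, fun _ _ => rfl⟩).congr ?_ (fun _ _ h => h) ?_
    · ext m
      simp [mixedSet]
    · rw [Finset.prod_empty]
  | insert l A hl ih =>
    refine (hasFrame_adjoin_pairs ih hl (Finset.univ.filter fun v => c v = l)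
      (fun v hv => (Finset.mem_filter.mp hv).2)).congr ?_ (fun _ _ h => h) ?_
    · ext m
      simp only [Set.mem_union, mixedSet, pairSet, Set.mem_ofPred_eq, Finset.mem_filter,
        Finset.mem_univ, true_and, Finset.mem_insert]
      constructor
      · rintro (⟨v, w, h1, h2, h3, h4⟩ | ⟨v, hv, w, hw, h1, h2⟩)
        · exact ⟨v, w, h1, h2, Or.inr h3, h4⟩
        · exact ⟨v, w, h1, hv.trans hw.symm, Or.inl hv, h2⟩
      · rintro ⟨v, w, h1, h2, h3 | h3, h4⟩
        · exact Or.inr ⟨v, h3, w, h2.symm.trans h3, h1, h4⟩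
        · exact Or.inl ⟨v, w, h1, h2, h3, h4⟩
    · rw [Finset.prod_insert hl, mul_comm]

end Coloring

/-! ### The Stanley–Reisner ideal of the complete multipartite graph -/

/-- The ideal is monomial, and a nonempty set of vertices is a nonface exactly when it contains two
distinct vertices of one part; such a pair is itself a nonface. -/
theorem mem_stanleyReisnerIdeal_iff {F : Type u} [Field F] {d : ℕ} (n : Fin d → ℕ)
    (p : MvPolynomial (Σ l : Fin d, Fin (n l)) F) :
    p ∈ stanleyReisnerIdeal F (cliqueComplex (completeMultipartite n)) ↔
      ∀ m, MvPolynomial.coeff m p ≠ 0 →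
        m ∈ mixedSet (Sigma.fst : (Σ l : Fin d, Fin (n l)) → Fin d) Finset.univ := by
  classical
  have h : stanleyReisnerIdeal F (cliqueComplex (completeMultipartite n)) =
      Ideal.span ((fun s => MvPolynomial.monomial s (1 : F)) ''
        {m | ∃ s : Finset (Σ l : Fin d, Fin (n l)), s.Nonempty ∧
          s ∉ (cliqueComplex (completeMultipartite n)).faces ∧
          m = ∑ v ∈ s, Finsupp.single v 1}) := by
    rw [stanleyReisnerIdeal]
    congr 1
    ext f
    simp only [Set.mem_ofPred_eq, Set.mem_image]
    constructor
    · rintro ⟨s, h1, h2, rfl⟩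
      refine ⟨_, ⟨s, h1, h2, rfl⟩, ?_⟩
      rw [MvPolynomial.monomial_sum_one]
      rfl
    · rintro ⟨_, ⟨s, h1, h2, rfl⟩, rfl⟩
      refine ⟨s, h1, h2, ?_⟩
      rw [MvPolynomial.monomial_sum_one]
      rfl
  have hs : ∀ (s : Finset (Σ l : Fin d, Fin (n l))) v,
      (∑ w ∈ s, Finsupp.single w 1 : (Σ l : Fin d, Fin (n l)) →₀ ℕ) v =
        if v ∈ s then 1 else 0 := by
    intro s v
    simp [Finsupp.finsetSum_apply, Finsupp.single_apply]
  rw [h, MvPolynomial.mem_ideal_span_monomial_image]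
  refine forall_congr' fun m => imp_congr MvPolynomial.mem_support_iff ?_
  constructor
  · rintro ⟨_, ⟨s, hne, hface, rfl⟩, hle⟩
    have hcl : ¬ (completeMultipartite n).IsClique (s : Set (Σ l : Fin d, Fin (n l))) :=
      fun h => hface ⟨hne, h⟩
    rw [SimpleGraph.isClique_iff, Set.Pairwise] at hcl
    push Not at hcl
    obtain ⟨v, hv, w, hw, hvw, hadj⟩ := hcl
    have hm : ∀ x ∈ s, m x ≠ 0 := by
      intro x hx h0
      have := hle x
      rw [hs, if_pos hx, h0] at this
      omega
    refine ⟨v, w, hvw, ?_, Finset.mem_univ _, hm v hv, hm w hw⟩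
    by_contra hc
    exact hadj hc
  · rintro ⟨v, w, hvw, hc, -, hv, hw⟩
    refine ⟨_, ⟨{v, w}, ⟨v, by simp⟩, ?_, rfl⟩, fun x => ?_⟩
    · rintro ⟨-, h⟩
      exact h (by simp) (by simp) hvw hc
    · rw [hs]
      split_ifs with hx
      · rcases Finset.mem_insert.mp hx with rfl | hx
        · omega
        · rw [Finset.mem_singleton.mp hx]
          omega
      · omega

theorem stanleyReisnerBetti_completeMultipartite {F : Type u} [Field F] {d : ℕ} (n : Fin d → ℕ)
    (i j : ℕ) :
    stanleyReisnerBetti F (cliqueComplex (completeMultipartite n)) i (i + j) =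
      ((∑ I ∈ Finset.powersetCard j (Finset.univ : Finset (Fin d)),
        ∑ c ∈ compositionsOn I i, ∏ l ∈ I, c l * (n l).choose (c l + 1) : ℕ) : Cardinal) := by
  obtain ⟨A, hA, hgen⟩ := hasFrame_mixedSet (F := F)
    (c := (Sigma.fst : (Σ l : Fin d, Fin (n l)) → Fin d)) Finset.univ
  have hcard : ∀ l : Fin d, (Finset.univ.filter
      fun v : Σ l : Fin d, Fin (n l) => v.1 = l).card = n l := by
    intro l
    have : (Finset.univ.filter fun v : Σ l : Fin d, Fin (n l) => v.1 = l) =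
        Finset.univ.map (Function.Embedding.sigmaMk l) := by
      ext ⟨k, x⟩
      simp only [Finset.mem_filter, Finset.mem_univ, true_and, Finset.mem_map]
      constructor
      · rintro rfl
        exact ⟨x, rfl⟩
      · rintro ⟨y, hy⟩
        exact (congrArg Sigma.fst hy).symm
    rw [this, Finset.card_map, Finset.card_univ, Fintype.card_fin]
  rw [stanleyReisnerBetti, A.gradedBetti_eq (mem_stanleyReisnerIdeal_iff n) _ ?_,
    A.card_eq_coeff_genFun, hgen, ← coeff_prod_one_add_pointSeries]
  · simp only [hcard]
  · intro k b b' hbb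
    -- Minimality: the reduced degree of a label equals its homological degree, so equal labels
    -- cannot occur in degrees `k + 1` and `k`.
    have h1 := (hA (k + 1) b).1
    rw [hbb, (hA k b').1] at h1
    omega

end GradedBetti

theorem mainTheorem10 {F : Type u} [Field F] {d : ℕ} (hd : 0 < d) (n : Fin d → ℕ)
    (hn : ∀ l, 0 < n l) :
    (∀ i j : ℕ,
      stanleyReisnerBetti F (cliqueComplex (completeMultipartite n)) i (i + j) =
        ((∑ I ∈ Finset.powersetCard j (Finset.univ : Finset (Fin d)),
          ∑ c ∈ compositionsOn I i, ∏ l ∈ I, c l * (n l).choose (c l + 1) : ℕ) : Cardinal)) ∧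
    (∀ k : ℕ, (∀ l, n l = k) → ∀ i j : ℕ,
      stanleyReisnerBetti F (cliqueComplex (completeMultipartite n)) i (i + j) =
        ((d.choose j * ∑ c ∈ compositionsOn (Finset.univ : Finset (Fin j)) i,
          ∏ l, c l * k.choose (c l + 1) : ℕ) : Cardinal)) := by
  refine ⟨GradedBetti.stanleyReisnerBetti_completeMultipartite n, fun k hk i j => ?_⟩
  rw [GradedBetti.stanleyReisnerBetti_completeMultipartite]
  congr 1
  have h : ∀ I ∈ Finset.powersetCard j (Finset.univ : Finset (Fin d)),
      ∑ c ∈ compositionsOn I i, ∏ l ∈ I, c l * (n l).choose (c l + 1) =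
        ∑ c ∈ compositionsOn (Finset.univ : Finset (Fin j)) i,
          ∏ l, c l * k.choose (c l + 1) := by
    intro I hI
    simp only [hk]
    -- With equal part sizes the inner sum depends only on the cardinality of `I`, so it may be
    -- indexed by `Fin j`.
    refine GradedBetti.sum_compositionsOn_congr I Finset.univ ?_ i k
    rw [(Finset.mem_powersetCard.mp hI).2, Finset.card_univ, Fintype.card_fin]
  rw [Finset.sum_congr rfl h, Finset.sum_const, Finset.card_powersetCard, Finset.card_univ,
    Fintype.card_fin, smul_eq_mul]
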